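/- Let $\Bbbk$ be an algebraically closed field of characteristic $0$, let $n,w$ be positive integers and $\gamma\in\Bbbk$ a primitive $n$-th root of unity. Let $H=B(n,w,\gamma)$ be the generalized Liu algebra: the Hopf algebra generated by $x^{\pm1},g,y$ with relations $$xx^{-1}=x^{-1}x=1,\quad xg=gx,\quad xy=yx,\quad yg=\gamma gy,\quad y^n=1-x^w=1-g^n,$$ where $x,g$ are group-like, $\Delta(y)=y\otimes g+1\otimes y$, $\varepsilon(y)=0$, $S(x)=x^{-1}$, $S(g)=g^{-1}$, $S(y)=-yg^{-1}$. Let $\alpha,\beta\in\Bbbk^*$ and $r,i\in\mathbb Z$ with $\alpha^w=\beta^n$, and let $V(\alpha,\beta,x^rg^i)$ be the following left-left Yetter-Drinfeld module over $H$. It has a basis $v_0,\dots,v_m$, where $m=n-1$ if $\beta^n\neq1$, and $m=n-\phi(-i-j)$ if $\beta=\gamma^j$ with $j\in\mathbb Z$; here $\phi(a)\in\{1,\dots,n\}$ is the integer congruent to $a$ modulo $n$. The action is $$x\cdot v_a=\alpha v_a,\qquad g\cdot v_a=\beta\gamma^{-a}v_a,\qquad y\cdot v_a=v_{a+1}\ (a<m),\qquad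 y\cdot v_m=(1-\beta^n)v_0,$$ and the coaction is $\delta(v_a)=\sum_{l=0}^a c(a,l)\otimes v_l$, where $c(0,0)=x^rg^i$ and, with the convention $c(a,l)=0$ for $l<0$ or $l>a$, $$c(a+1,l)=c(a,l)S(y)+\beta\gamma^{-l}\,y\,c(a,l)S(g)+c(a,l-1)S(g)\qquad(0\le l\le a+1).$$ For a Yetter-Drinfeld module $V$ over $H$ the Nichols algebra is $\mathcal B(V)=T(V)/\bigoplus_{N\ge2}\ker\Delta_{1^N}$. Here $\Delta\colon T(V)\to T(V)\otimes T(V)$ is the algebra map into the braided tensor product algebra with $\Delta(v)=v\otimes1+1\otimes v$ for $v\in V$, and $\Delta_{1^N}\colon V^{\otimes N}\to V^{\otimes N}$ is the restriction to $V^{\otimes N}$ of $\pi_1^{\otimes N}\circ\Delta^{N-1}$, where $\Delta^{N-1}\colon T(V)\to T(V)^{\otimes N}$ is the iterated comultiplication and $\pi_1\colon T(V)\to V$ is the projection onto degree one. If neither $\alpha$ nor $\beta$ is a root of unity, then the Nichols algebra $\mathcal B(V(\alpha,\beta,x^rg^i))$ is infinite-dimensional. -/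

import Mathlib

open scoped TensorProduct

namespace LiuYD

section GaussBinomial
variable {k : Type*} [Field k]

/-- The Gaussian binomial coefficients `binom(m, l)_q`. -/
def gaussBinom (q : k) : ℕ → ℕ → k
  | _, 0 => 1
  | 0, _ + 1 => 0
  | m + 1, l + 1 => gaussBinom q m l + q ^ (l + 1) * gaussBinom q m (l + 1)

@[simp] lemma gaussBinom_zero_right (q : k) (m : ℕ) : gaussBinom q m 0 = 1 := by
  cases m <;> rfl

lemma gaussBinom_succ (q : k) (m l : ℕ) : gaussBinom q (m + 1) (l + 1) =
    gaussBinom q m l + q ^ (l + 1) * gaussBinom q m (l + 1) := rfl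

lemma gaussBinom_lt (q : k) : ∀ {m l : ℕ}, m < l → gaussBinom q m l = 0
  | _, 0, h => absurd h (Nat.not_lt_zero _)
  | 0, _ + 1, _ => rfl
  | m + 1, l + 1, h => by
    rw [gaussBinom_succ, gaussBinom_lt q (by omega : m < l),
      gaussBinom_lt q (by omega : m < l + 1)]
    ring

@[simp] lemma gaussBinom_self (q : k) : ∀ m : ℕ, gaussBinom q m m = 1
  | 0 => rfl
  | m + 1 => by
    rw [gaussBinom_succ, gaussBinom_self q m, gaussBinom_lt q (by omega : m < m + 1)]
    ring

lemma gaussBinom_succ' (q : k) (d : ℕ) : ∀ (l : ℕ), gaussBinom q (l + d + 1) (l + 1) =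
    gaussBinom q (l + d) (l + 1) + q ^ d * gaussBinom q (l + d) l := by
  suffices h : ∀ m l d : ℕ, m = l + d → gaussBinom q (m + 1) (l + 1) =
    gaussBinom q m (l + 1) + q ^ d * gaussBinom q m l from fun l => h _ l d rfl
  intro m
  induction m with
  | zero =>
    intro l d h
    obtain rfl : l = 0 := by omega
    obtain rfl : d = 0 := by omega
    simp [gaussBinom]
  | succ m ih =>
    intro l d h
    rcases l with _ | l
    · obtain rfl : d = m + 1 := by omega
      have h1 := ih 0 m (by omega)
      have h2 := gaussBinom_succ q m 0
      rw [gaussBinom_succ, h1]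
      simp only [gaussBinom_zero_right, zero_add, pow_one] at h1 h2 ⊢
      linear_combination h1 - h2
    · rcases Nat.eq_zero_or_pos d with rfl | hd
      · obtain rfl : m = l := by omega
        simp [gaussBinom_lt q (by omega : m + 1 < m + 1 + 1)]
      · obtain ⟨e, rfl⟩ : ∃ e, d = e + 1 := ⟨d - 1, by omega⟩
        have h1 := ih l (e + 1) (by omega)
        have h2 := ih (l + 1) e (by omega)
        rw [gaussBinom_succ q (m + 1) (l + 1), h1, h2]
        have h3 := gaussBinom_succ q m l
        have h4 := gaussBinom_succ q m (l + 1)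
        linear_combination h2 - h4 + q ^ (e + 1) * (h1 - h3)

lemma gaussBinom_absorb (q : k) : ∀ m l : ℕ,
    (q ^ (l + 1) - 1) * gaussBinom q (m + 1) (l + 1) = (q ^ (m + 1) - 1) * gaussBinom q m l := by
  intro m
  induction m with
  | zero =>
    intro l
    rcases l with _ | l
    · simp [gaussBinom]
    · simp [gaussBinom]
  | succ m ih =>
    intro l
    have h1 := ih l
    rw [gaussBinom_succ q (m + 1) l]
    rcases l with _ | l
    · simp at h1 ⊢
      linear_combination q * h1
    · have h2 := ih l
      have h3 := gaussBinom_succ q m l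
      linear_combination q ^ (l + 2) * h1 + q * h2 - q * (q ^ (m + 1) - 1) * h3

lemma gaussBinom_eq_zero {q : k} {n : ℕ} (hq : IsPrimitiveRoot q n) {l : ℕ} (h0 : 0 < l)
    (hl : l < n) : gaussBinom q n l = 0 := by
  obtain ⟨l, rfl⟩ : ∃ e, l = e + 1 := ⟨l - 1, by omega⟩
  obtain ⟨n, rfl⟩ : ∃ e, n = e + 1 := ⟨n - 1, by omega⟩
  have h := gaussBinom_absorb q n l
  rw [hq.pow_eq_one, sub_self, zero_mul] at h
  exact (mul_eq_zero.1 h).resolve_left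
    (sub_ne_zero.2 (hq.pow_ne_one_of_pos_of_lt (by omega) hl))

variable {A : Type*} [Ring A] [Algebra k A]

lemma qcomm_pow {q : k} {a b : A} (h : b * a = q • (a * b)) (l : ℕ) :
    b * a ^ l = q ^ l • (a ^ l * b) := by
  induction l with
  | zero => simp
  | succ l ih =>
    rw [pow_succ, ← mul_assoc, ih, smul_mul_assoc, mul_assoc, h, mul_smul_comm, smul_smul,
      pow_succ, mul_assoc]

/-- The quantum binomial formula. -/
lemma add_pow_qcomm {q : k} {a b : A} (h : b * a = q • (a * b)) (m : ℕ) :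
    (a + b) ^ m = ∑ l ∈ Finset.range (m + 1), gaussBinom q m l • (a ^ l * b ^ (m - l)) := by
  induction m with
  | zero => simp
  | succ m ih =>
    rw [pow_succ', ih, Finset.sum_range_succ' _ (m + 1), add_mul]
    have hb : b * ∑ l ∈ Finset.range (m + 1), gaussBinom q m l • (a ^ l * b ^ (m - l)) =
        ∑ l ∈ Finset.range (m + 2), (q ^ l * gaussBinom q m l) • (a ^ l * b ^ (m + 1 - l)) := by
      rw [Finset.sum_range_succ _ (m + 1), gaussBinom_lt q (by omega : m < m + 1), Finset.mul_sum]
      simp only [mul_zero, zero_smul, add_zero]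
      refine Finset.sum_congr rfl fun l hl => ?_
      rw [Finset.mem_range] at hl
      rw [mul_smul_comm, ← mul_assoc, qcomm_pow h, smul_mul_assoc, smul_smul, mul_assoc,
        ← pow_succ', mul_comm, show m - l + 1 = m + 1 - l by omega]
    rw [hb, Finset.sum_range_succ' _ (m + 1), Finset.mul_sum, ← add_assoc, ← Finset.sum_add_distrib]
    congr 1
    · refine Finset.sum_congr rfl fun l hl => ?_
      rw [mul_smul_comm, ← mul_assoc, ← pow_succ', gaussBinom_succ, add_smul,
        show m + 1 - (l + 1) = m - l by omega]
    · simp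

lemma add_pow_primitive {q : k} {n : ℕ} (hn : 0 < n) (hq : IsPrimitiveRoot q n) {a b : A}
    (h : b * a = q • (a * b)) : (a + b) ^ n = a ^ n + b ^ n := by
  rw [add_pow_qcomm h, Finset.sum_range_succ]
  obtain ⟨n, rfl⟩ : ∃ e, n = e + 1 := ⟨n - 1, by omega⟩
  rw [Finset.sum_range_succ', Finset.sum_eq_zero]
  · simp [add_comm]
  · intro l hl
    rw [Finset.mem_range] at hl
    rw [gaussBinom_eq_zero hq (by omega) (by omega), zero_smul]

lemma neg_mul_pow_qcomm {q : k} {n : ℕ} (hn : 0 < n) (hq : IsPrimitiveRoot q n) {a b : A}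
    (h : b * a = q • (a * b)) : (-(a * b)) ^ n = -(a ^ n * b ^ n) := by
  have key : ∀ m : ℕ, (a * b) ^ m = q ^ (m * (m - 1) / 2) • (a ^ m * b ^ m) := by
    intro m
    induction m with
    | zero => simp
    | succ m ih =>
      have e : (m + 1) * (m + 1 - 1) / 2 = m + m * (m - 1) / 2 := by
        rw [← Finset.sum_range_id_mul_two, ← Finset.sum_range_id_mul_two,
          Nat.mul_div_cancel _ two_pos, Nat.mul_div_cancel _ two_pos, Finset.sum_range_succ,
          add_comm]
      rw [pow_succ', ih, e, mul_smul_comm, mul_assoc, ← mul_assoc b, qcomm_pow h, smul_mul_assoc,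
        mul_smul_comm, smul_smul, ← pow_add, add_comm m, ← mul_assoc, ← mul_assoc, ← pow_succ',
        mul_assoc, ← pow_succ']
  have hs : (-1 : k) ^ n * q ^ (n * (n - 1) / 2) = -1 := by
    rcases Nat.even_or_odd n with he | ho
    · obtain ⟨r, hr⟩ := he
      have h2 : q ^ r = -1 := by
        have h3 : (q ^ r) ^ 2 = 1 := by rw [← pow_mul, ← hq.pow_eq_one]; congr 1; omega
        exact (sq_eq_one_iff.1 h3).resolve_left
          (hq.pow_ne_one_of_pos_of_lt (by omega) (by omega))
      have e : n * (n - 1) / 2 = r * (n - 1) := by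
        rw [show n * (n - 1) = r * (n - 1) * 2 by rw [hr]; ring, Nat.mul_div_cancel _ two_pos]
      rw [e, pow_mul, h2, Even.neg_one_pow ⟨r, hr⟩, Odd.neg_one_pow ⟨r - 1, by omega⟩, one_mul]
    · obtain ⟨r, hr⟩ := ho
      have e : n * (n - 1) / 2 = n * r := by
        rw [show n * (n - 1) = n * r * 2 by rw [hr]; simp; ring, Nat.mul_div_cancel _ two_pos]
      rw [e, pow_mul, hq.pow_eq_one, one_pow, Odd.neg_one_pow ⟨r, hr⟩, mul_one]
  have hm : (-(a * b)) ^ n = (-1 : k) ^ n • (a * b) ^ n := by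
    rw [← smul_pow, neg_one_smul]
  rw [hm, key, smul_smul, hs, neg_one_smul]

end GaussBinomial


section GeneralizedLiu
variable {k : Type*} [Field k]

/-- The parameters of a generalized Liu algebra over `k`: positive integers `n`, `w` and a
primitive `n`-th root of unity `γ`. -/
structure LiuParam (k : Type*) [Field k] where
  n : ℕ
  w : ℕ
  γ : k
  n_pos : 0 < n
  w_pos : 0 < w
  prim : IsPrimitiveRoot γ n

/-- The four generators `x`, `x⁻¹`, `g`, `y`. -/
inductive LiuGen : Type
  | x
  | xInv
  | g
  | y

open FreeAlgebra in
/-- The defining relations of `B(n, w, γ)`. -/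
inductive LiuRel (P : LiuParam k) : FreeAlgebra k LiuGen → FreeAlgebra k LiuGen → Prop
  | x_mul_xInv : LiuRel P (ι k .x * ι k .xInv) 1
  | xInv_mul_x : LiuRel P (ι k .xInv * ι k .x) 1
  | x_mul_g : LiuRel P (ι k .x * ι k .g) (ι k .g * ι k .x)
  | x_mul_y : LiuRel P (ι k .x * ι k .y) (ι k .y * ι k .x)
  | y_mul_g : LiuRel P (ι k .y * ι k .g) (P.γ • (ι k .g * ι k .y))
  | y_pow : LiuRel P (ι k .y ^ P.n) (1 - ι k .x ^ P.w)
  | g_pow : LiuRel P (1 - ι k .x ^ P.w) (1 - ι k .g ^ P.n)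

/-- The generalized Liu algebra `B(n, w, γ)`. -/
def GenLiu (P : LiuParam k) : Type _ := RingQuot (LiuRel P)

namespace GenLiu

noncomputable instance (P : LiuParam k) : Ring (GenLiu P) :=
  inferInstanceAs (Ring (RingQuot (LiuRel P)))

noncomputable instance (P : LiuParam k) : Algebra k (GenLiu P) :=
  inferInstanceAs (Algebra k (RingQuot (LiuRel P)))

/-- The image of a generator in `B(n, w, γ)`. -/
noncomputable def gen (P : LiuParam k) (a : LiuGen) : GenLiu P :=
  RingQuot.mkAlgHom k (LiuRel P) (FreeAlgebra.ι k a)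

section
variable (P : LiuParam k)

/-- The generator `x`. -/
noncomputable abbrev x : GenLiu P := gen P .x
/-- The generator `x⁻¹`. -/
noncomputable abbrev xInv : GenLiu P := gen P .xInv
/-- The generator `g`. -/
noncomputable abbrev g : GenLiu P := gen P .g
/-- The generator `y`. -/
noncomputable abbrev y : GenLiu P := gen P .y

lemma x_mul_xInv : x P * xInv P = 1 := by
  simpa [gen] using! RingQuot.mkAlgHom_rel k (LiuRel.x_mul_xInv (P := P))

lemma xInv_mul_x : xInv P * x P = 1 := by
  simpa [gen] using! RingQuot.mkAlgHom_rel k (LiuRel.xInv_mul_x (P := P))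

lemma x_mul_g : x P * g P = g P * x P := by
  simpa [gen] using! RingQuot.mkAlgHom_rel k (LiuRel.x_mul_g (P := P))

lemma x_mul_y : x P * y P = y P * x P := by
  simpa [gen] using! RingQuot.mkAlgHom_rel k (LiuRel.x_mul_y (P := P))

lemma y_mul_g : y P * g P = P.γ • (g P * y P) := by
  simpa [gen] using! RingQuot.mkAlgHom_rel k (LiuRel.y_mul_g (P := P))

lemma y_pow : y P ^ P.n = 1 - x P ^ P.w := by
  simpa [gen] using! RingQuot.mkAlgHom_rel k (LiuRel.y_pow (P := P))

lemma g_pow : g P ^ P.n = x P ^ P.w := by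
  have h := RingQuot.mkAlgHom_rel k (LiuRel.g_pow (P := P))
  simp only [map_sub, map_one, map_pow] at h
  exact (sub_right_injective h).symm

end

variable {P : LiuParam k} {A : Type*} [Ring A] [Algebra k A]

variable (P) in
/-- The elements `f x`, `f x⁻¹`, `f g`, `f y` satisfy the relations of `B(n, w, γ)`. -/
structure Sat (f : LiuGen → A) : Prop where
  h₁ : f .x * f .xInv = 1
  h₂ : f .xInv * f .x = 1
  h₃ : f .x * f .g = f .g * f .x
  h₄ : f .x * f .y = f .y * f .x
  h₅ : f .y * f .g = P.γ • (f .g * f .y)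
  h₆ : f .y ^ P.n = 1 - f .x ^ P.w
  h₇ : 1 - f .x ^ P.w = 1 - f .g ^ P.n

/-- The universal property of `B(n, w, γ)`. -/
noncomputable def lift (f : LiuGen → A) (h : Sat P f) : GenLiu P →ₐ[k] A :=
  RingQuot.liftAlgHom k ⟨FreeAlgebra.lift k f, by
    obtain ⟨h₁, h₂, h₃, h₄, h₅, h₆, h₇⟩ := h
    intro a b hab
    cases hab <;> first | simpa | simpa using h₇⟩

lemma lift_gen (f : LiuGen → A) (h : Sat P f) (a : LiuGen) : lift f h (gen P a) = f a := by
  simpa [lift, gen] using!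
    RingQuot.liftAlgHom_mkAlgHom_apply k (FreeAlgebra.lift k f) _ (FreeAlgebra.ι k a)

lemma hom_ext {f f' : GenLiu P →ₐ[k] A} (h : ∀ a, f (gen P a) = f' (gen P a)) : f = f' := by
  refine RingQuot.ringQuot_ext' k (s := LiuRel P) f f' (FreeAlgebra.hom_ext ?_)
  funext a
  exact h a

lemma induction {C : GenLiu P → Prop} (halg : ∀ r : k, C (algebraMap k _ r))
    (hgen : ∀ a, C (gen P a)) (hmul : ∀ a b, C a → C b → C (a * b))
    (hadd : ∀ a b, C a → C b → C (a + b)) (a : GenLiu P) : C a := by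
  obtain ⟨a, rfl⟩ := RingQuot.mkAlgHom_surjective k (LiuRel P) a
  induction a using FreeAlgebra.induction with
  | grade0 r => rw [AlgHom.commutes]; exact halg r
  | grade1 a => exact hgen a
  | mul a b ha hb => rw [map_mul]; exact hmul _ _ ha hb
  | add a b ha hb => rw [map_add]; exact hadd _ _ ha hb

variable (P)

/-- The unit of `B(n, w, γ)` given by `x`. -/
noncomputable def xU : (GenLiu P)ˣ := ⟨x P, xInv P, x_mul_xInv P, xInv_mul_x P⟩

lemma commute_xU_g : Commute (xU P : GenLiu P) (g P) := x_mul_g P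
lemma commute_xU_y : Commute (xU P : GenLiu P) (y P) := x_mul_y P

/-- The unit of `B(n, w, γ)` given by `g`, whose inverse is `g ^ (n - 1) x ^ (-w)`. -/
noncomputable def gU : (GenLiu P)ˣ where
  val := g P
  inv := g P ^ (P.n - 1) * xInv P ^ P.w
  val_inv := by
    rw [← mul_assoc, ← pow_succ', Nat.sub_add_cancel P.n_pos, g_pow]
    exact (((xU P) ^ P.w).mul_inv)
  inv_val := by
    have h : Commute (xInv P) (g P) := (commute_xU_g P).units_inv_left
    rw [mul_assoc, (h.pow_left _).eq, ← mul_assoc, ← pow_succ, Nat.sub_add_cancel P.n_pos, g_pow]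
    exact (((xU P) ^ P.w).mul_inv)

/-- The inverse of `g`. -/
noncomputable abbrev gInv : GenLiu P := ((gU P)⁻¹ : (GenLiu P)ˣ)

lemma g_mul_gInv : g P * gInv P = 1 := (gU P).mul_inv
lemma gInv_mul_g : gInv P * g P = 1 := (gU P).inv_mul

lemma gInv_mul_y : gInv P * y P = P.γ • (y P * gInv P) := by
  calc gInv P * y P = gInv P * (y P * g P) * gInv P := by
        rw [mul_assoc, mul_assoc, g_mul_gInv, mul_one]
    _ = P.γ • (y P * gInv P) := by
        rw [y_mul_g, mul_smul_comm, ← mul_assoc, gInv_mul_g, one_mul, smul_mul_assoc]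

lemma commute_xInv_y : Commute (xInv P) (y P) := (commute_xU_y P).units_inv_left
lemma commute_xInv_g : Commute (xInv P) (g P) := (commute_xU_g P).units_inv_left
lemma commute_xInv_gInv : Commute (xInv P) (gInv P) :=
  ((show Commute (xU P : GenLiu P) (gU P) from commute_xU_g P).units_inv_left).units_inv_right

lemma gInv_pow : gInv P ^ P.n = xInv P ^ P.w := by
  have h : gU P ^ P.n = xU P ^ P.w := Units.ext (by simpa [gU, xU] using g_pow P)
  have h2 : (gU P)⁻¹ ^ P.n = (xU P)⁻¹ ^ P.w := by rw [inv_pow, h, inv_pow]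
  simpa using! congrArg Units.val h2

/-- The values of the comultiplication on generators: `x`, `g` are group-like and
`Δ(y) = y ⊗ g + 1 ⊗ y`. -/
noncomputable def comulGen : LiuGen → GenLiu P ⊗[k] GenLiu P
  | .x => x P ⊗ₜ x P
  | .xInv => xInv P ⊗ₜ xInv P
  | .g => g P ⊗ₜ g P
  | .y => y P ⊗ₜ g P + 1 ⊗ₜ y P

lemma comulGen_sat : Sat P (comulGen P) where
  h₁ := by simp [comulGen, x_mul_xInv, Algebra.TensorProduct.one_def]
  h₂ := by simp [comulGen, xInv_mul_x, Algebra.TensorProduct.one_def]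
  h₃ := by simp [comulGen, x_mul_g]
  h₄ := by simp [comulGen, x_mul_g, x_mul_y, mul_add, add_mul]
  h₅ := by simp [comulGen, y_mul_g, mul_add, add_mul, TensorProduct.smul_tmul']
  h₆ := by
      rw [comulGen, comulGen, add_pow_primitive P.n_pos P.prim (by simp [y_mul_g])]
      simp [y_pow, g_pow, Algebra.TensorProduct.one_def, TensorProduct.sub_tmul,
        TensorProduct.tmul_sub]
  h₇ := by simp [comulGen, g_pow]

/-- The comultiplication of `B(n, w, γ)`. -/
noncomputable def comulHom : GenLiu P →ₐ[k] GenLiu P ⊗[k] GenLiu P :=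
  lift (comulGen P) (comulGen_sat P)

/-- The values of the counit on generators. -/
def counitGen : LiuGen → k
  | .x => 1
  | .xInv => 1
  | .g => 1
  | .y => 0

lemma counitGen_sat : Sat P (counitGen (k := k)) where
  h₁ := by simp [counitGen]
  h₂ := by simp [counitGen]
  h₃ := by simp [counitGen]
  h₄ := by simp [counitGen]
  h₅ := by simp [counitGen]
  h₆ := by simp [counitGen, P.n_pos.ne']
  h₇ := by simp [counitGen]

/-- The counit of `B(n, w, γ)`. -/
noncomputable def counitHom : GenLiu P →ₐ[k] k :=
  lift (counitGen) (counitGen_sat P)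

@[simp] lemma comulHom_gen (a : LiuGen) : comulHom P (gen P a) = comulGen P a :=
  lift_gen ..
@[simp] lemma counitHom_gen (a : LiuGen) : counitHom P (gen P a) = counitGen a :=
  lift_gen ..

noncomputable instance : Bialgebra k (GenLiu P) :=
  Bialgebra.ofAlgHom (comulHom P) (counitHom P)
    (hom_ext fun a => by
      cases a <;>
        simp [comulGen, Algebra.TensorProduct.one_def, TensorProduct.add_tmul,
          TensorProduct.tmul_add, add_assoc])
    (hom_ext fun a => by cases a <;> simp [comulGen, counitGen])
    (hom_ext fun a => by cases a <;> simp [comulGen, counitGen])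

open Coalgebra

lemma comul_eq (a : GenLiu P) : comul (R := k) a = comulHom P a := rfl
lemma counit_eq (a : GenLiu P) : counit (R := k) a = counitHom P a := rfl

open MulOpposite in
/-- The values of the antipode on generators: `S(x) = x⁻¹`, `S(g) = g⁻¹`, `S(y) = -y g⁻¹`. -/
noncomputable def antipodeGen : LiuGen → (GenLiu P)ᵐᵒᵖ
  | .x => op (xInv P)
  | .xInv => op (x P)
  | .g => op (gInv P)
  | .y => op (-(y P * gInv P))

lemma antipodeGen_sat : Sat P (antipodeGen P) where
  h₁ := by simp [antipodeGen, ← MulOpposite.op_mul, x_mul_xInv]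
  h₂ := by simp [antipodeGen, ← MulOpposite.op_mul, xInv_mul_x]
  h₃ := by simp [antipodeGen, ← MulOpposite.op_mul, (commute_xInv_gInv P).eq]
  h₄ := by
      simp [antipodeGen, ← MulOpposite.op_mul, -MulOpposite.op_neg,
        ((commute_xInv_y P).mul_right (commute_xInv_gInv P)).eq]
  h₅ := by
      simp only [antipodeGen, ← MulOpposite.op_mul, ← MulOpposite.op_smul, mul_neg, neg_mul,
        smul_neg]
      rw [← mul_assoc, gInv_mul_y, smul_mul_assoc]
  h₆ := by
      simp only [antipodeGen, ← MulOpposite.op_pow]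
      rw [neg_mul_pow_qcomm P.n_pos P.prim (gInv_mul_y P), y_pow, gInv_pow, sub_mul, one_mul,
        show x P ^ P.w * xInv P ^ P.w = 1 from ((xU P) ^ P.w).mul_inv]
      simp
  h₇ := by
      simp only [antipodeGen, ← MulOpposite.op_pow]
      rw [gInv_pow]

/-- The antipode of `B(n, w, γ)` as an algebra map to the opposite algebra. -/
noncomputable def antipodeHom : GenLiu P →ₐ[k] (GenLiu P)ᵐᵒᵖ :=
  lift (antipodeGen P) (antipodeGen_sat P)

/-- The antipode of `B(n, w, γ)`. -/
noncomputable def antipodeLin : GenLiu P →ₗ[k] GenLiu P :=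
  (MulOpposite.opLinearEquiv k).symm.toLinearMap ∘ₗ (antipodeHom P).toLinearMap

lemma antipodeLin_gen (a : LiuGen) :
    antipodeLin P (gen P a) = (antipodeGen P a).unop := by
  exact congrArg MulOpposite.unop (lift_gen ..)

lemma antipodeLin_mul (a b : GenLiu P) :
    antipodeLin P (a * b) = antipodeLin P b * antipodeLin P a := by
  simp [antipodeLin]

lemma antipodeLin_one : antipodeLin P 1 = 1 := by
  simp [antipodeLin]

noncomputable instance : HopfAlgebra k (GenLiu P) where
  antipode := antipodeLin P
  mul_antipode_rTensor_comul := by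
    have key : ∀ (s t : GenLiu P ⊗[k] GenLiu P) (r : k),
        LinearMap.mul' k _ ((antipodeLin P).rTensor _ s) = algebraMap k _ r →
        LinearMap.mul' k _ ((antipodeLin P).rTensor _ (s * t)) =
          algebraMap k _ r * LinearMap.mul' k _ ((antipodeLin P).rTensor _ t) := by
      intro s t r hs
      induction t using TensorProduct.induction_on with
      | zero => simp
      | add t t' ht ht' => rw [mul_add, map_add, map_add, ht, ht', map_add, map_add, mul_add]
      | tmul a b =>
        have h : LinearMap.mul' k _ ((antipodeLin P).rTensor _ (s * a ⊗ₜ b)) =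
            antipodeLin P a * LinearMap.mul' k _ ((antipodeLin P).rTensor _ s) * b := by
          clear hs
          induction s using TensorProduct.induction_on with
          | zero => simp
          | add s s' hs hs' =>
            rw [add_mul, map_add, map_add, hs, hs', map_add, map_add, mul_add, add_mul]
          | tmul c d => simp [antipodeLin_mul, mul_assoc]
        rw [h, hs]
        simp [← Algebra.commutes, mul_assoc]
    refine LinearMap.ext fun a => ?_
    induction a using induction with
    | halg r =>
      simp [Algebra.algebraMap_eq_smul_one, Algebra.TensorProduct.one_def, antipodeLin_one]
    | hgen a =>
      cases a <;> simp [comul_eq, counit_eq, comulGen, counitGen, antipodeLin_gen, antipodeGen,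
        antipodeLin_one, x_mul_xInv, xInv_mul_x, gInv_mul_g, mul_assoc]
    | hmul a b ha hb =>
      simp only [LinearMap.comp_apply] at ha hb ⊢
      rw [Bialgebra.comul_mul, key _ _ _ ha, hb]
      simp
    | hadd a b ha hb => rw [map_add, ha, hb, map_add]
  mul_antipode_lTensor_comul := by
    have key : ∀ (s t : GenLiu P ⊗[k] GenLiu P) (r : k),
        LinearMap.mul' k _ ((antipodeLin P).lTensor _ t) = algebraMap k _ r →
        LinearMap.mul' k _ ((antipodeLin P).lTensor _ (s * t)) =
          LinearMap.mul' k _ ((antipodeLin P).lTensor _ s) * algebraMap k _ r := by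
      intro s t r ht
      induction s using TensorProduct.induction_on with
      | zero => simp
      | add s s' hs hs' => rw [add_mul, map_add, map_add, hs, hs', map_add, map_add, add_mul]
      | tmul a b =>
        have h : LinearMap.mul' k _ ((antipodeLin P).lTensor _ (a ⊗ₜ b * t)) =
            a * LinearMap.mul' k _ ((antipodeLin P).lTensor _ t) * antipodeLin P b := by
          clear ht
          induction t using TensorProduct.induction_on with
          | zero => simp
          | add s s' hs hs' =>
            rw [mul_add, map_add, map_add, hs, hs', map_add, map_add, mul_add, add_mul]
          | tmul c d => simp [antipodeLin_mul, mul_assoc]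
        rw [h, ht]
        simp [Algebra.commutes, mul_assoc]
    refine LinearMap.ext fun a => ?_
    induction a using induction with
    | halg r =>
      simp [Algebra.algebraMap_eq_smul_one, Algebra.TensorProduct.one_def, antipodeLin_one]
    | hgen a =>
      cases a <;> simp [comul_eq, counit_eq, comulGen, counitGen, antipodeLin_gen, antipodeGen,
        x_mul_xInv, xInv_mul_x, g_mul_gInv]
    | hmul a b ha hb =>
      simp only [LinearMap.comp_apply] at ha hb ⊢
      rw [Bialgebra.comul_mul, key _ _ _ hb, ha]
      simp
    | hadd a b ha hb => rw [map_add, ha, hb, map_add]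

open HopfAlgebra

lemma antipode_gen (a : LiuGen) : antipode k (gen P a) = (antipodeGen P a).unop :=
  antipodeLin_gen P a

end GenLiu
end GeneralizedLiu

section YetterDrinfeld
open Coalgebra HopfAlgebra

section
variable (k H V : Type*) [Field k] [Ring H] [HopfAlgebra k H]
  [AddCommGroup V] [Module k V] [Module H V] [IsScalarTower k H V]

/-- The linear map `H ⊗ (H ⊗ H) → End (H ⊗ V)` sending `a ⊗ (b ⊗ c)` to
`u ⊗ v ↦ a u S(c) ⊗ b • v`. -/
noncomputable def ydTriple : H ⊗[k] (H ⊗[k] H) →ₗ[k] Module.End k (H ⊗[k] V) :=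
  TensorProduct.homTensorHomMap (RingHom.id k) H V H V ∘ₗ
    TensorProduct.map
      (TensorProduct.lift ((LinearMap.mul k (Module.End k H)).compl₁₂
        (LinearMap.mul k H) ((LinearMap.mul k H).flip ∘ₗ antipode k)))
      (Algebra.lsmul k k V).toLinearMap ∘ₗ
    (TensorProduct.assoc k H H H).symm.toLinearMap ∘ₗ
    (TensorProduct.comm k H H).toLinearMap.lTensor H

variable {k H V} in
@[simp] lemma ydTriple_tmul (a b c u : H) (v : V) :
    ydTriple k H V (a ⊗ₜ (b ⊗ₜ c)) (u ⊗ₜ v) = (a * (u * antipode k c)) ⊗ₜ (b • v) := by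
  simp [ydTriple]

/-- For `h : H` the map `H ⊗ V → H ⊗ V`,
`u ⊗ v ↦ h₍₁₎ u S(h₍₃₎) ⊗ h₍₂₎ • v`. -/
noncomputable def ydTwist : H →ₗ[k] Module.End k (H ⊗[k] V) :=
  ydTriple k H V ∘ₗ (comul (R := k) (A := H)).lTensor H ∘ₗ comul

variable {k H V} in
lemma ydTriple_mul (s t : H ⊗[k] (H ⊗[k] H)) :
    ydTriple k H V (s * t) = ydTriple k H V s * ydTriple k H V t := by
  have h : (LinearMap.mul k (H ⊗[k] (H ⊗[k] H))).compr₂ (ydTriple k H V) =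
      (LinearMap.mul k (Module.End k (H ⊗[k] V))).compl₁₂ (ydTriple k H V) (ydTriple k H V) := by
    ext a b c a' b' c' u v
    simp [HopfAlgebra.antipode_mul_antidistrib, mul_assoc, mul_smul]
  exact LinearMap.congr_fun₂ h s t

variable {k H V} in
lemma ydTwist_mul (a b : H) : ydTwist k H V (a * b) = ydTwist k H V a * ydTwist k H V b := by
  have h : ∀ s t : H ⊗[k] H, (comul (R := k) (A := H)).lTensor H (s * t) =
      (comul (R := k) (A := H)).lTensor H s * (comul (R := k) (A := H)).lTensor H t :=
    map_mul (Algebra.TensorProduct.map (AlgHom.id k H) (Bialgebra.comulAlgHom k H))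
  simp only [ydTwist, LinearMap.comp_apply, Bialgebra.comul_mul, h, ydTriple_mul]

variable {k H V} in
lemma ydTwist_one : ydTwist k H V 1 = 1 := by
  refine TensorProduct.ext' fun u v => ?_
  simp [ydTwist, Algebra.TensorProduct.one_def]

/-- A (left-left) Yetter-Drinfeld module over the Hopf algebra `H`: a left `H`-module `V` with a
left `H`-comodule structure `coact` satisfying
`δ(h • v) = h₍₁₎ v₍₋₁₎ S(h₍₃₎) ⊗ h₍₂₎ • v₍₀₎`. -/
class YetterDrinfeld where
  /-- The coaction `δ : V → H ⊗ V`. -/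
  coact : V →ₗ[k] H ⊗[k] V
  coassoc : (TensorProduct.assoc k H H V).toLinearMap ∘ₗ
    (comul (R := k) (A := H)).rTensor V ∘ₗ coact = coact.lTensor H ∘ₗ coact
  counit_coact : (TensorProduct.lid k V).toLinearMap ∘ₗ
    (counit (R := k) (A := H)).rTensor V ∘ₗ coact = LinearMap.id
  compat : ∀ (h : H) (v : V), coact (h • v) = ydTwist k H V h (coact v)

end

/-! ### The braided tensor algebra of a Yetter-Drinfeld module -/

section
variable (k H V : Type*) [Field k] [Ring H] [HopfAlgebra k H]
  [AddCommGroup V] [Module k V] [Module H V] [IsScalarTower k H V]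

/-- The diagonal action of `H` on `T(V)`: the unique one extending the action on `V` with
`h • (s t) = (h₍₁₎ • s) (h₍₂₎ • t)` and `h • 1 = ε(h) 1`, that is, such that
`t ↦ (h ↦ h • t)` is an algebra map to the convolution algebra `Hom(H, T(V))`. -/
noncomputable def tensorActConv :
    TensorAlgebra k V →ₐ[k] WithConv (H →ₗ[k] TensorAlgebra k V) :=
  TensorAlgebra.lift k ((WithConv.linearEquiv k (H →ₗ[k] TensorAlgebra k V)).symm.toLinearMap ∘ₗ
    (Algebra.lsmul k k V).toLinearMap.flip.compr₂ (TensorAlgebra.ι k))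

/-- The diagonal action of `H` on `T(V)` as a bilinear map. -/
noncomputable def tensorAct : H →ₗ[k] TensorAlgebra k V →ₗ[k] TensorAlgebra k V :=
  ((WithConv.linearEquiv k (H →ₗ[k] TensorAlgebra k V)).toLinearMap ∘ₗ
    (tensorActConv k H V).toLinearMap).flip

variable [YetterDrinfeld k H V]

/-- The coaction of `H` on `T(V)`: the algebra map `T(V) → H ⊗ T(V)` extending the coaction on
`V`. -/
noncomputable def tensorCoact : TensorAlgebra k V →ₐ[k] H ⊗[k] TensorAlgebra k V :=
  TensorAlgebra.lift k ((TensorAlgebra.ι k).lTensor H ∘ₗ YetterDrinfeld.coact)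

/-- The braiding `c : T(V) ⊗ T(V) → T(V) ⊗ T(V)`, `s ⊗ t ↦ s₍₋₁₎ • t ⊗ s₍₀₎`. -/
noncomputable def tensorBraiding :
    TensorAlgebra k V ⊗[k] TensorAlgebra k V →ₗ[k] TensorAlgebra k V ⊗[k] TensorAlgebra k V :=
  (TensorProduct.lift (tensorAct k H V)).rTensor _ ∘ₗ
    (TensorProduct.assoc k H _ _).symm.toLinearMap ∘ₗ
    (TensorProduct.comm k _ _).toLinearMap.lTensor H ∘ₗ
    (TensorProduct.assoc k H _ _).toLinearMap ∘ₗ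
    (tensorCoact k H V).toLinearMap.rTensor _

/-- The multiplication of the braided tensor product algebra `T(V) ⊗ T(V)`:
`(a ⊗ b) (a' ⊗ b') = a (b₍₋₁₎ • a') ⊗ b₍₀₎ b'`. -/
noncomputable def braidedMul :
    TensorAlgebra k V ⊗[k] TensorAlgebra k V →ₗ[k]
      TensorAlgebra k V ⊗[k] TensorAlgebra k V →ₗ[k]
        TensorAlgebra k V ⊗[k] TensorAlgebra k V :=
  TensorProduct.curry
    (TensorProduct.map (LinearMap.mul' k _) (LinearMap.mul' k _) ∘ₗ
      (TensorProduct.assoc k _ _ _).symm.toLinearMap ∘ₗ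
      ((TensorProduct.assoc k _ _ _).toLinearMap ∘ₗ (tensorBraiding k H V).rTensor _ ∘ₗ
        (TensorProduct.assoc k _ _ _).symm.toLinearMap).lTensor _ ∘ₗ
      (TensorProduct.assoc k _ _ _).toLinearMap)

/-- The comultiplication `Δ` of `T(V)`: the algebra map from `T(V)` to the braided tensor product
algebra with `Δ(v) = v ⊗ 1 + 1 ⊗ v`. It is obtained by letting `T(V)` act on `T(V) ⊗ T(V)` so that
each `v : V` acts as left multiplication by `v ⊗ 1 + 1 ⊗ v`, and evaluating at `1 ⊗ 1`;
so `Δ(1) = 1 ⊗ 1` and `Δ(v t) = (v ⊗ 1 + 1 ⊗ v) Δ(t)`. -/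
noncomputable def tensorComul :
    TensorAlgebra k V →ₗ[k] TensorAlgebra k V ⊗[k] TensorAlgebra k V :=
  (LinearMap.applyₗ (1 ⊗ₜ 1)) ∘ₗ
    (TensorAlgebra.lift k (A := Module.End k (TensorAlgebra k V ⊗[k] TensorAlgebra k V))
      (braidedMul k H V ∘ₗ
        ((TensorProduct.mk k _ _).flip 1 ∘ₗ TensorAlgebra.ι k +
          TensorProduct.mk k _ _ 1 ∘ₗ TensorAlgebra.ι k))).toLinearMap

lemma tensorComul_one : tensorComul k H V 1 = 1 ⊗ₜ 1 := by
  simp [tensorComul]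

lemma tensorComul_ι_mul (v : V) (t : TensorAlgebra k V) :
    tensorComul k H V (TensorAlgebra.ι k v * t) =
      braidedMul k H V (TensorAlgebra.ι k v ⊗ₜ 1 + 1 ⊗ₜ TensorAlgebra.ι k v)
        (tensorComul k H V t) := by
  simp [tensorComul]

end

section
variable (k : Type*) [Field k] {C : Type*} [AddCommGroup C] [Module k C]

/-- The map `C ⊗ C^{⊗ m} → C^{⊗ (m + 1)}`, `c ⊗ (c₁ ⊗ ⋯ ⊗ cₘ) ↦ c ⊗ c₁ ⊗ ⋯ ⊗ cₘ`. -/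
noncomputable def tensorCons (m : ℕ) :
    C ⊗[k] (PiTensorProduct k fun _ : Fin m => C) →ₗ[k]
      PiTensorProduct k fun _ : Fin (m + 1) => C :=
  TensorProduct.lift ((PiTensorProduct.lift :
      MultilinearMap k (fun _ : Fin m => C) (PiTensorProduct k fun _ : Fin (m + 1) => C) ≃ₗ[k] _
      ).toLinearMap ∘ₗ
    (PiTensorProduct.tprod k : MultilinearMap k (fun _ : Fin (m + 1) => C) _).curryLeft)

lemma tensorCons_tmul_tprod (m : ℕ) (c : C) (f : Fin m → C) :
    tensorCons k m (c ⊗ₜ PiTensorProduct.tprod k f) = PiTensorProduct.tprod k (Fin.cons c f) := by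
  simp [tensorCons]

variable {k} in
/-- The iterated comultiplication `Δ^m : C → C^{⊗ (m + 1)}`, with `Δ^0 = id` and
`Δ^{m + 1} = (id ⊗ Δ^m) Δ`. -/
noncomputable def iterComul (Δ : C →ₗ[k] C ⊗[k] C) :
    (m : ℕ) → C →ₗ[k] PiTensorProduct k fun _ : Fin (m + 1) => C
  | 0 => (PiTensorProduct.subsingletonEquiv (R := k) (s := fun _ : Fin 1 => C) 0).symm.toLinearMap
  | m + 1 => tensorCons k (m + 1) ∘ₗ (iterComul Δ m).lTensor C ∘ₗ Δ

end

section
variable (k H V : Type*) [Field k] [Ring H] [HopfAlgebra k H]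
  [AddCommGroup V] [Module k V] [Module H V] [IsScalarTower k H V] [YetterDrinfeld k H V]

/-- The map `π₁^{⊗ (m + 1)} Δ^m : T(V) → V^{⊗ (m + 1)}`, whose restriction to the homogeneous
component of degree `m + 1` is `Δ_{1^{m + 1}}`; the projection `π₁` of `T(V)` onto its component `V`
of degree one is `TensorAlgebra.ιInv`. -/
noncomputable def deltaOne (m : ℕ) :
    TensorAlgebra k V →ₗ[k] PiTensorProduct k fun _ : Fin (m + 1) => V :=
  PiTensorProduct.map (fun _ => TensorAlgebra.ιInv) ∘ₗ iterComul (tensorComul k H V) m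

/-- The homogeneous component of degree `m` of `T(V)`. -/
noncomputable def tensorDegree (m : ℕ) : Submodule k (TensorAlgebra k V) :=
  LinearMap.range (TensorAlgebra.ι k : V →ₗ[k] TensorAlgebra k V) ^ m

/-- The defining ideal `⨁_{m ≥ 2} ker Δ_{1^m}` of the Nichols algebra, where `Δ_{1^m}` is
considered on the component of degree `m`; here `m = j + 2`. -/
noncomputable def nicholsIdeal : Submodule k (TensorAlgebra k V) :=
  ⨆ j : ℕ, tensorDegree k V (j + 2) ⊓ LinearMap.ker (deltaOne k H V (j + 1))

/-- The Nichols algebra `B(V) = T(V) / ⨁_{m ≥ 2} ker Δ_{1^m}` of a Yetter-Drinfeld module, as a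
vector space. -/
abbrev NicholsAlgebra : Type _ := TensorAlgebra k V ⧸ nicholsIdeal k H V

end
end YetterDrinfeld

section SimpleModules
variable {k : Type*} [Field k]

open GenLiu HopfAlgebra Coalgebra

/-- For `n ≥ 1` and an integer `a`, the unique element of `{1, …, n}` congruent to `a` modulo `n`. -/
def phi (n : ℕ) (a : ℤ) : ℕ := ((a - 1) % n + 1).toNat

lemma phi_spec {n : ℕ} (hn : 0 < n) (a : ℤ) :
    1 ≤ phi n a ∧ phi n a ≤ n ∧ ∃ t : ℤ, (phi n a : ℤ) = a + n * t := by
  have h1 := Int.emod_nonneg (a - 1) (by omega : (n : ℤ) ≠ 0)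
  have h2 := Int.emod_lt_of_pos (a - 1) (by omega : (0 : ℤ) < n)
  have h3 := Int.emod_add_mul_ediv (a - 1) n
  have h4 : (phi n a : ℤ) = (a - 1) % n + 1 := by rw [phi]; omega
  refine ⟨by omega, by omega, -((a - 1) / n), ?_⟩
  rw [h4]
  linear_combination h3

section Coefficients
variable (P : LiuParam k)

/-- The group-like element `x ^ r g ^ i` of `B(n, w, γ)`. -/
noncomputable def grpLike (r i : ℤ) : GenLiu P := ((xU P ^ r * gU P ^ i : (GenLiu P)ˣ) : GenLiu P)

/-- The elements `c_β^{r,i}(a, l)` of `B(n, w, γ)`, defined recursively for `0 ≤ l ≤ a`, and extended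
by `0` to `l > a`. -/
noncomputable def coef (β : k) (r i : ℤ) : ℕ → ℕ → GenLiu P
  | 0, 0 => grpLike P r i
  | 0, _ + 1 => 0
  | a + 1, 0 => coef β r i a 0 * antipode k (y P) +
      β • (y P * coef β r i a 0 * antipode k (g P))
  | a + 1, l + 1 => coef β r i a (l + 1) * antipode k (y P) +
      (β * (P.γ ^ (l + 1))⁻¹) • (y P * coef β r i a (l + 1) * antipode k (g P)) +
      coef β r i a l * antipode k (g P)

variable {P}

lemma antipode_x : antipode k (x P) = xInv P := antipode_gen P .x
lemma antipode_xInv : antipode k (xInv P) = x P := antipode_gen P .xInv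
lemma antipode_g : antipode k (g P) = gInv P := antipode_gen P .g
lemma antipode_y : antipode k (y P) = -(y P * gInv P) := antipode_gen P .y

variable (P) in
lemma γ_ne : P.γ ≠ 0 := P.prim.ne_zero P.n_pos.ne'

lemma coef_of_lt (β : k) (r i : ℤ) : ∀ {a l : ℕ}, a < l → coef P β r i a l = 0
  | _, 0, h => absurd h (Nat.not_lt_zero _)
  | 0, _ + 1, _ => by rw [coef]
  | a + 1, l + 1, h => by
    rw [coef, coef_of_lt β r i (by omega : a < l), coef_of_lt β r i (by omega : a < l + 1)]
    simp

lemma g_mul_y : g P * y P = P.γ⁻¹ • (y P * g P) := by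
  rw [y_mul_g, smul_smul, inv_mul_cancel₀ (γ_ne P), one_smul]

lemma gz_mul_y (a : ℤ) : ((gU P ^ a : (GenLiu P)ˣ) : GenLiu P) * y P =
    (P.γ ^ a)⁻¹ • (y P * ((gU P ^ a : (GenLiu P)ˣ) : GenLiu P)) := by
  induction a using Int.induction_on with
  | zero => simp
  | succ a ih =>
    rw [zpow_add_one, zpow_add_one₀ (γ_ne P), Units.val_mul, mul_assoc,
      show (gU P : GenLiu P) * y P = P.γ⁻¹ • (y P * (gU P : GenLiu P)) from g_mul_y,
      mul_smul_comm, ← mul_assoc, ih, smul_mul_assoc, smul_smul, mul_inv, mul_assoc, mul_comm P.γ⁻¹]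
  | pred a ih =>
    rw [zpow_sub_one, zpow_sub_one₀ (γ_ne P), Units.val_mul, mul_assoc, gInv_mul_y,
      mul_smul_comm, ← mul_assoc, ih, smul_mul_assoc, smul_smul, mul_inv, mul_assoc, inv_inv,
      mul_comm P.γ]

lemma x_central (h : GenLiu P) : Commute (x P) h := by
  induction h using GenLiu.induction with
  | halg r => exact (Algebra.commutes r _).symm
  | hgen a =>
    cases a
    · exact Commute.refl _
    · exact (x_mul_xInv P).trans (xInv_mul_x P).symm
    · exact x_mul_g P
    · exact x_mul_y P
  | hmul a b ha hb => exact ha.mul_right hb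
  | hadd a b ha hb => exact ha.add_right hb

lemma xz_central (r : ℤ) (h : GenLiu P) : Commute ((xU P ^ r : (GenLiu P)ˣ) : GenLiu P) h := by
  induction r using Int.induction_on with
  | zero => simp
  | succ r ih =>
    rw [zpow_add_one, Units.val_mul]
    exact ih.mul_left (x_central h)
  | pred r ih =>
    rw [zpow_sub_one, Units.val_mul]
    exact ih.mul_left (show Commute (xU P : GenLiu P) h from x_central h).units_inv_left

lemma grpLike_mul_gInv (r i : ℤ) : grpLike P r i * gInv P = grpLike P r (i - 1) := by
  rw [grpLike, grpLike, ← Units.val_mul, mul_assoc, zpow_sub_one]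

lemma grpLike_mul_y (r i : ℤ) : grpLike P r i * y P = (P.γ ^ i)⁻¹ • (y P * grpLike P r i) := by
  rw [grpLike, Units.val_mul, mul_assoc, gz_mul_y, mul_smul_comm, ← mul_assoc,
    (xz_central r (y P)).eq, mul_assoc]

/-- The scalars `λ_β^i(a, l)` in closed form. -/
noncomputable def lam (γ β : k) (i : ℤ) (a l : ℕ) : k :=
  gaussBinom γ a l * (γ ^ ((a - l) * l))⁻¹ * ∏ t ∈ Finset.Ico l a, (β - γ ^ (t - i : ℤ))

lemma lam_succ_zero (γ β : k) (i : ℤ) (a : ℕ) :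
    lam γ β i (a + 1) 0 = (β - γ ^ (a - i : ℤ)) * lam γ β i a 0 := by
  simp only [lam, gaussBinom_zero_right, mul_zero, pow_zero, inv_one, mul_one, one_mul]
  rw [Finset.prod_Ico_succ_top (Nat.zero_le _), mul_comm]

lemma lam_succ_succ {γ : k} (hγ : γ ≠ 0) (β : k) (i : ℤ) {a l : ℕ} (h : l ≤ a) :
    lam γ β i (a + 1) (l + 1) =
      (β * (γ ^ (l + 1))⁻¹ - γ ^ (a - i : ℤ)) * lam γ β i a (l + 1) + lam γ β i a l := by
  rcases h.eq_or_lt with rfl | h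
  · simp [lam, gaussBinom_lt γ (Nat.lt_succ_self l)]
  · obtain ⟨d, rfl⟩ : ∃ d, a = l + 1 + d := ⟨a - (l + 1), by omega⟩
    have h1 := gaussBinom_succ γ (l + 1 + d) l
    have h2 := gaussBinom_succ' γ (d + 1) l
    rw [show l + (d + 1) = l + 1 + d by omega] at h2
    simp only [lam]
    rw [Finset.prod_Ico_succ_top (by omega : l + 1 ≤ l + 1 + d),
      Finset.prod_eq_prod_Ico_succ_bot (by omega : l < l + 1 + d),
      show l + 1 + d + 1 - (l + 1) = d + 1 by omega, show l + 1 + d - (l + 1) = d by omega,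
      show l + 1 + d - l = d + 1 by omega]
    generalize ∏ t ∈ Finset.Ico (l + 1) (l + 1 + d), (β - γ ^ (t - i : ℤ)) = Q
    have e1 : γ ^ (((l + 1 + d : ℕ) : ℤ) - i) = γ ^ l * γ ^ (d + 1) * γ ^ (-i) := by
      rw [← pow_add, ← zpow_natCast γ, ← zpow_add₀ hγ]; congr 1; push_cast; ring
    have e2 : γ ^ ((l : ℤ) - i) = γ ^ l * γ ^ (-i) := by
      rw [← zpow_natCast γ, ← zpow_add₀ hγ]; congr 1
    have e3 : γ ^ ((d + 1) * (l + 1)) = γ ^ (d * l) * γ ^ d * γ ^ l * γ := by ring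
    have e4 : γ ^ (d * (l + 1)) = γ ^ (d * l) * γ ^ d := by ring
    have e5 : γ ^ ((d + 1) * l) = γ ^ (d * l) * γ ^ l := by ring
    rw [e1, e2, e3, e4, e5]
    rw [pow_succ γ l] at h1
    rw [pow_succ γ d] at h2
    have h3 : γ ^ l ≠ 0 := pow_ne_zero _ hγ
    have h4 : γ ^ d ≠ 0 := pow_ne_zero _ hγ
    have h5 : γ ^ (d * l) ≠ 0 := pow_ne_zero _ hγ
    rw [pow_succ γ l, pow_succ γ d]
    generalize γ ^ l = L at *
    generalize γ ^ d = D at *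
    generalize γ ^ (d * l) = E at *
    generalize γ ^ (-i) = I at *
    field_simp
    linear_combination Q * (β * h2 - L * D * γ * I * h1)

lemma coef_eq (β : k) (r i : ℤ) : ∀ a l : ℕ, l ≤ a →
    coef P β r i a l = lam P.γ β i a l • (y P ^ (a - l) * grpLike P r (i - a)) := by
  have hy : ∀ (a : ℕ) (u : GenLiu P), u * grpLike P r (i - a) * antipode k (y P) =
      -(P.γ ^ (a - i : ℤ)) • (u * y P * grpLike P r (i - (a + 1 : ℕ))) := by
    intro a u
    rw [antipode_y, mul_assoc, mul_neg, ← mul_assoc (grpLike P r _), grpLike_mul_y,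
      smul_mul_assoc, mul_assoc (y P), grpLike_mul_gInv, mul_neg, mul_smul_comm, ← mul_assoc,
      neg_smul, ← zpow_neg, neg_sub, Nat.cast_succ, sub_sub]
  have hg : ∀ (a : ℕ) (u : GenLiu P), u * grpLike P r (i - a) * antipode k (g P) =
      u * grpLike P r (i - (a + 1 : ℕ)) := by
    intro a u
    rw [antipode_g, mul_assoc, grpLike_mul_gInv, Nat.cast_succ, sub_sub]
  intro a
  induction a with
  | zero =>
    intro l hl
    obtain rfl : l = 0 := by omega
    simp [coef, lam]
  | succ a ih =>
    intro l hl
    rcases l with _ | l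
    · rw [coef, ih 0 (Nat.zero_le _), lam_succ_zero]
      simp only [smul_mul_assoc, mul_smul_comm]
      rw [hy, ← mul_assoc (y P), hg, Nat.sub_zero, Nat.sub_zero, ← pow_succ, ← pow_succ']
      module
    · have e : a + 1 - (l + 1) = a - l := by omega
      rw [coef, lam_succ_succ (γ_ne P) β i (by omega), ih l (by omega), e]
      rcases (show l = a ∨ l + 1 ≤ a by omega) with rfl | hl'
      · rw [coef_of_lt β r i (Nat.lt_succ_self l)]
        simp only [smul_mul_assoc]
        rw [hg]
        simp [lam, gaussBinom_lt P.γ (Nat.lt_succ_self l)]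
      · rw [ih (l + 1) hl']
        simp only [smul_mul_assoc, mul_smul_comm]
        rw [hy, ← mul_assoc (y P), hg, hg, ← pow_succ, ← pow_succ',
          show a - (l + 1) + 1 = a - l by omega]
        module

lemma prod_root (β : k) (i : ℤ) :
    ∏ t ∈ Finset.Ico 0 P.n, (β - P.γ ^ (t - i : ℤ)) = β ^ P.n - 1 := by
  have hne := γ_ne P
  have : NeZero P.n := ⟨P.n_pos.ne'⟩
  have h := congrArg (Polynomial.eval β) (Polynomial.X_pow_sub_one_eq_prod P.n_pos P.prim)
  simp only [Polynomial.eval_sub, Polynomial.eval_pow, Polynomial.eval_X, Polynomial.eval_one,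
    Polynomial.eval_prod, Polynomial.eval_C] at h
  rw [h]
  refine Finset.prod_bij (fun t _ => P.γ ^ (t - i : ℤ)) ?_ ?_ ?_ ?_
  · intro t _
    rw [Polynomial.mem_nthRootsFinset P.n_pos, ← zpow_natCast, ← zpow_mul, mul_comm, zpow_mul,
      zpow_natCast, P.prim.pow_eq_one, one_zpow]
  · intro s hs t ht hst
    rw [Finset.mem_Ico] at hs ht
    rw [zpow_sub₀ hne, zpow_sub₀ hne] at hst
    have := mul_right_cancel₀ (inv_ne_zero (zpow_ne_zero i hne)) (by simpa [div_eq_mul_inv] using hst)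
    exact P.prim.pow_inj hs.2 ht.2 (by exact_mod_cast this)
  · intro b hb
    rw [Polynomial.mem_nthRootsFinset P.n_pos] at hb
    have h1 : (b * P.γ ^ i) ^ P.n = 1 := by
      rw [mul_pow, hb, one_mul, ← zpow_natCast, ← zpow_mul, mul_comm, zpow_mul, zpow_natCast,
        P.prim.pow_eq_one, one_zpow]
    obtain ⟨t, ht, hb'⟩ := P.prim.eq_pow_of_pow_eq_one h1
    refine ⟨t, by simpa using ht, ?_⟩
    rw [zpow_sub₀ hne, zpow_natCast, hb', mul_div_assoc, div_self (zpow_ne_zero i hne), mul_one]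
  · intro t _; rfl

lemma g_mul_coef (β : k) (r i : ℤ) (a l : ℕ) :
    g P * coef P β r i a l = (P.γ ^ l * (P.γ ^ a)⁻¹) • (coef P β r i a l * g P) := by
  have hne := γ_ne P
  have hSy : g P * antipode k (y P) = P.γ⁻¹ • (antipode k (y P) * g P) := by
    rw [antipode_y, mul_neg, neg_mul, mul_assoc, gInv_mul_g, ← mul_assoc, g_mul_y, smul_mul_assoc,
      mul_assoc, g_mul_gInv, smul_neg]
  have hSg : g P * antipode k (g P) = antipode k (g P) * g P := by
    rw [antipode_g, g_mul_gInv, gInv_mul_g]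
  have t1 : ∀ (u : GenLiu P) (s : k), g P * u = s • (u * g P) →
      g P * (u * antipode k (y P)) = (s * P.γ⁻¹) • (u * antipode k (y P) * g P) := by
    intro u s hu
    rw [← mul_assoc, hu, smul_mul_assoc, mul_assoc, hSy, mul_smul_comm, smul_smul, mul_assoc]
  have t2 : ∀ (u : GenLiu P) (s : k), g P * u = s • (u * g P) →
      g P * (u * antipode k (g P)) = s • (u * antipode k (g P) * g P) := by
    intro u s hu
    rw [← mul_assoc, hu, smul_mul_assoc, mul_assoc, hSg, mul_assoc]
  have t3 : ∀ (u : GenLiu P) (s : k), g P * u = s • (u * g P) →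
      g P * (y P * u) = (s * P.γ⁻¹) • (y P * u * g P) := by
    intro u s hu
    rw [← mul_assoc, g_mul_y, smul_mul_assoc, mul_assoc, hu, mul_smul_comm, smul_smul, mul_assoc,
      mul_comm]
  have t4 : ∀ (u v : GenLiu P) (s : k), g P * u = s • (u * g P) → g P * v = s • (v * g P) →
      g P * (u + v) = s • ((u + v) * g P) := by
    intro u v s hu hv
    rw [mul_add, hu, hv, add_mul, smul_add]
  have t5 : ∀ (u : GenLiu P) (s c : k), g P * u = s • (u * g P) →
      g P * (c • u) = s • (c • u * g P) := by
    intro u s c hu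
    rw [mul_smul_comm, hu, smul_mul_assoc, smul_comm]
  induction a generalizing l with
  | zero =>
    rcases l with _ | l
    · rw [coef, grpLike]
      have h1 := (xz_central r (g P)).eq
      have h2 : (gU P : GenLiu P) * ((gU P ^ i : (GenLiu P)ˣ) : GenLiu P) =
          ((gU P ^ i : (GenLiu P)ˣ) : GenLiu P) * (gU P : GenLiu P) := by
        rw [← Units.val_mul, ← Units.val_mul, ((Commute.refl (gU P)).zpow_right i).eq]
      rw [Units.val_mul, ← mul_assoc, ← h1, mul_assoc]
      rw [show g P * _ = _ from h2, ← mul_assoc]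
      simp [gU]
    · simp [coef]
  | succ a ih =>
    have hs : ∀ l : ℕ, P.γ ^ l * (P.γ ^ (a + 1))⁻¹ = P.γ ^ l * (P.γ ^ a)⁻¹ * P.γ⁻¹ := by
      intro l; rw [pow_succ, mul_inv, mul_assoc]
    rcases l with _ | l
    · rw [coef, hs]
      exact t4 _ _ _ (t1 _ _ (ih 0)) (t5 _ _ _ (t2 _ _ (t3 _ _ (ih 0))))
    · rw [coef, hs]
      refine t4 _ _ _ (t4 _ _ _ (t1 _ _ (ih _)) (t5 _ _ _ (t2 _ _ (t3 _ _ (ih _))))) ?_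
      have : P.γ ^ (l + 1) * (P.γ ^ a)⁻¹ * P.γ⁻¹ = P.γ ^ l * (P.γ ^ a)⁻¹ := by
        field_simp
        ring
      rw [this]
      exact t2 _ _ (ih l)

end Coefficients

/-- The parameters `(α, β, r, i)` of the types `(α, β, x ^ r g ^ i)` of standard elements:
`α, β` are non-zero scalars with `α ^ w = β ^ n`, and `r`, `i` are integers. -/
structure StdType (P : LiuParam k) where
  α : k
  β : k
  r : ℤ
  i : ℤ
  α_ne : α ≠ 0
  β_ne : β ≠ 0
  rel : α ^ P.w = β ^ P.n

namespace StdType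
variable {P : LiuParam k} (τ : StdType P)

open Classical in
/-- The index `m` of the last vector of the basis `v_0, …, v_m` of `V(α, β, x ^ r g ^ i)`:
`m = n - φ(-i - j)` if `β = γ ^ j` for an integer `j`, and `m = n - 1` otherwise
(that is, if `β ^ n ≠ 1`). -/
noncomputable def top : ℕ :=
  if h : ∃ j : ℤ, τ.β = P.γ ^ j then P.n - phi P.n (-τ.i - h.choose) else P.n - 1

lemma top_cases : (τ.β ^ P.n = 1 ∧ τ.top + 1 ≤ P.n ∧ τ.β = P.γ ^ (τ.top - τ.i : ℤ)) ∨
    (τ.β ^ P.n ≠ 1 ∧ τ.top + 1 = P.n) := by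
  have hn := P.n_pos
  rw [top]
  split_ifs with h
  · left
    have hj := h.choose_spec
    generalize h.choose = j at hj ⊢
    obtain ⟨h1, h2, t, ht⟩ := phi_spec P.n_pos (-τ.i - j)
    have hγ : ∀ s : ℤ, P.γ ^ ((P.n : ℤ) * s) = 1 := by
      intro s; rw [zpow_mul, zpow_natCast, P.prim.pow_eq_one, one_zpow]
    refine ⟨?_, by omega, ?_⟩
    · rw [hj, ← zpow_natCast, ← zpow_mul, mul_comm, hγ]
    · rw [hj, Nat.cast_sub h2, ht,
        show (P.n : ℤ) - (-τ.i - j + P.n * t) - τ.i = j + P.n * (1 - t) by ring,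
        zpow_add₀ (γ_ne P), hγ, mul_one]
  · right
    refine ⟨fun hβ => h ?_, by omega⟩
    have : NeZero P.n := ⟨P.n_pos.ne'⟩
    obtain ⟨j, _, hj⟩ := P.prim.eq_pow_of_pow_eq_one hβ
    exact ⟨j, by rw [zpow_natCast, hj]⟩

end StdType

/-- The vector space underlying `V(α, β, x ^ r g ^ i)`, with basis `v_0, …, v_m`. -/
def StdModule {P : LiuParam k} (τ : StdType P) : Type _ := Fin (τ.top + 1) →₀ k

namespace StdModule
variable {P : LiuParam k} (τ : StdType P)

noncomputable instance : AddCommGroup (StdModule τ) :=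
  inferInstanceAs (AddCommGroup (Fin (τ.top + 1) →₀ k))

noncomputable instance : Module k (StdModule τ) :=
  inferInstanceAs (Module k (Fin (τ.top + 1) →₀ k))

/-- The basis `v_0, …, v_m`. -/
noncomputable def basis : Module.Basis (Fin (τ.top + 1)) k (StdModule τ) :=
  ⟨LinearEquiv.refl k (Fin (τ.top + 1) →₀ k)⟩

/-- The operators by which the generators of `B(n, w, γ)` act on `V(α, β, x ^ r g ^ i)`:
`x v_a = α v_a`, `g v_a = β γ ^ (-a) v_a`, `y v_a = v_{a + 1}` for `a < m` and
`y v_m = (1 - β ^ n) v_0`. -/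
noncomputable def actGen : LiuGen → Module.End k (StdModule τ)
  | .x => τ.α • LinearMap.id
  | .xInv => τ.α⁻¹ • LinearMap.id
  | .g => (basis τ).constr k fun a => (τ.β * (P.γ ^ (a : ℕ))⁻¹) • basis τ a
  | .y => (basis τ).constr k fun a =>
      if h : (a : ℕ) < τ.top then basis τ ⟨a + 1, by omega⟩
      else (1 - τ.β ^ P.n) • basis τ 0

/-- The basis vector `v_a`, extended by `0` to `a > m`. -/
noncomputable def vec (a : ℕ) : StdModule τ :=
  if h : a < τ.top + 1 then basis τ ⟨a, h⟩ else 0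

lemma basis_eq (a : Fin (τ.top + 1)) : basis τ a = vec τ a := by
  rw [vec, dif_pos a.2]

lemma ext_vec {M : Type*} [AddCommGroup M] [Module k M] {f f' : StdModule τ →ₗ[k] M}
    (h : ∀ a : ℕ, a ≤ τ.top → f (vec τ a) = f' (vec τ a)) : f = f' :=
  (basis τ).ext fun a => by rw [basis_eq]; exact h a (by omega)

lemma actGen_g_vec (a : ℕ) : actGen τ .g (vec τ a) = (τ.β * (P.γ ^ a)⁻¹) • vec τ a := by
  rw [vec]
  split_ifs with h
  · simp [actGen]
  · simp

lemma actGen_y_vec {a : ℕ} (h : a < τ.top) : actGen τ .y (vec τ a) = vec τ (a + 1) := by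
  rw [vec, dif_pos (by omega), vec, dif_pos (by omega), actGen, Module.Basis.constr_basis]
  exact dif_pos h

lemma actGen_y_top : actGen τ .y (vec τ τ.top) = (1 - τ.β ^ P.n) • vec τ 0 := by
  rw [vec, dif_pos (by omega), vec, dif_pos (by omega), actGen, Module.Basis.constr_basis]
  exact dif_neg (lt_irrefl _)

lemma actGen_y_pow {a b : ℕ} (h : a + b ≤ τ.top) :
    (actGen τ .y ^ b) (vec τ a) = vec τ (a + b) := by
  induction b with
  | zero => simp
  | succ b ih =>
    rw [pow_succ', Module.End.mul_apply, ih (by omega), actGen_y_vec τ (by omega), add_assoc]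

lemma actGen_y_pow_top (a : ℕ) (h : a ≤ τ.top) :
    (actGen τ .y ^ (τ.top + 1)) (vec τ a) = (1 - τ.β ^ P.n) • vec τ a := by
  obtain ⟨b, hb⟩ := Nat.exists_eq_add_of_le h
  rw [show τ.top + 1 = a + (1 + b) by omega, pow_add, pow_add, Module.End.mul_apply,
    Module.End.mul_apply, actGen_y_pow τ (by omega), ← hb, pow_one, actGen_y_top, map_smul,
    actGen_y_pow τ (by omega), zero_add]

lemma actGen_y_pow_n : actGen τ .y ^ P.n = (1 - τ.β ^ P.n) • LinearMap.id := by
  refine ext_vec τ fun a ha => ?_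
  rcases τ.top_cases with ⟨h1, h2, -⟩ | ⟨-, h2⟩
  · rw [show P.n = (P.n - (τ.top + 1)) + (τ.top + 1) by omega, pow_add, Module.End.mul_apply,
      actGen_y_pow_top τ a ha, ← show P.n = (P.n - (τ.top + 1)) + (τ.top + 1) by omega, h1]
    simp
  · rw [← h2, actGen_y_pow_top τ a ha, h2]
    simp

lemma actGen_sat : Sat P (actGen τ) where
  h₁ := by
    refine LinearMap.ext fun v => ?_
    simp [actGen, smul_smul, τ.α_ne]
  h₂ := by
    refine LinearMap.ext fun v => ?_
    simp [actGen, smul_smul, τ.α_ne]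
  h₃ := LinearMap.ext fun v => by simp [actGen]
  h₄ := LinearMap.ext fun v => by simp [actGen]
  h₅ := by
    have hne := γ_ne P
    refine ext_vec τ fun a ha => ?_
    rw [Module.End.mul_apply, LinearMap.smul_apply, Module.End.mul_apply, actGen_g_vec, map_smul]
    rcases ha.eq_or_lt with rfl | ha
    · rw [actGen_y_top, map_smul, actGen_g_vec, smul_smul, smul_smul, smul_smul]
      congr 1
      rcases τ.top_cases with ⟨h1, -, -⟩ | ⟨-, h2⟩
      · rw [h1]; ring
      · have h3 := P.prim.pow_eq_one
        rw [← h2, pow_succ] at h3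
        rw [inv_eq_of_mul_eq_one_right h3]
        simp
        ring
    · rw [actGen_y_vec τ ha, actGen_g_vec, smul_smul]
      congr 1
      field_simp
      ring
  h₆ := by
    rw [actGen_y_pow_n, ← τ.rel]
    refine LinearMap.ext fun v => ?_
    simp [actGen, smul_pow, sub_smul, ← Module.End.one_eq_id]
  h₇ := by
    congr 1
    have hg : ∀ b a : ℕ, (actGen τ .g ^ b) (vec τ a) = (τ.β * (P.γ ^ a)⁻¹) ^ b • vec τ a := by
      intro b a
      induction b with
      | zero => simp
      | succ b ih =>
        rw [pow_succ', Module.End.mul_apply, ih, map_smul, actGen_g_vec, smul_smul, pow_succ]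
    refine ext_vec τ fun a _ => ?_
    rw [hg, mul_pow, inv_pow, ← pow_mul, mul_comm a, pow_mul, P.prim.pow_eq_one, one_pow, inv_one,
      mul_one, ← τ.rel]
    simp [actGen, smul_pow, ← Module.End.one_eq_id]

/-- The representation of `B(n, w, γ)` on `V(α, β, x ^ r g ^ i)`. -/
noncomputable def rep : GenLiu P →ₐ[k] Module.End k (StdModule τ) :=
  GenLiu.lift (actGen τ) (actGen_sat τ)

noncomputable instance : Module (GenLiu P) (StdModule τ) :=
  Module.compHom (StdModule τ) (rep τ).toRingHom

lemma smul_def (h : GenLiu P) (v : StdModule τ) : h • v = rep τ h v := rfl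

lemma gen_smul (a : LiuGen) (v : StdModule τ) : gen P a • v = actGen τ a v := by
  rw [smul_def, rep, GenLiu.lift_gen]

instance : IsScalarTower k (GenLiu P) (StdModule τ) where
  smul_assoc c h v := by rw [smul_def, smul_def, map_smul, LinearMap.smul_apply]

/-- The coaction `δ(v_a) = ∑_{l ≤ a} c_β^{r,i}(a, l) ⊗ v_l`; recall that `c_β^{r,i}(a, l) = 0` for
`l > a`. -/
noncomputable def coact : StdModule τ →ₗ[k] GenLiu P ⊗[k] StdModule τ :=
  (basis τ).constr k fun a => ∑ l : Fin (τ.top + 1), coef P τ.β τ.r τ.i a l ⊗ₜ basis τ l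

lemma coact_vec {a : ℕ} (h : a ≤ τ.top) : coact τ (vec τ a) =
    ∑ l ∈ Finset.range (τ.top + 1), coef P τ.β τ.r τ.i a l ⊗ₜ vec τ l := by
  rw [vec, dif_pos (by omega), coact, Module.Basis.constr_basis, Finset.sum_range]
  simp only [basis_eq]

lemma comul_grpLike (r i : ℤ) :
    comul (R := k) (grpLike P r i) = grpLike P r i ⊗ₜ[k] grpLike P r i := by
  let d : GenLiu P →* GenLiu P ⊗[k] GenLiu P :=
    { toFun := fun h => h ⊗ₜ h
      map_one' := Algebra.TensorProduct.one_def.symm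
      map_mul' := fun a b => (Algebra.TensorProduct.tmul_mul_tmul a b a b).symm }
  let f : GenLiu P →* GenLiu P ⊗[k] GenLiu P := (comulHom P : GenLiu P →* GenLiu P ⊗[k] GenLiu P)
  have hx : Units.map f (xU P) = Units.map d (xU P) := Units.ext (comulHom_gen P .x)
  have hg : Units.map f (gU P) = Units.map d (gU P) := Units.ext (comulHom_gen P .g)
  have h : Units.map f (xU P ^ r * gU P ^ i) = Units.map d (xU P ^ r * gU P ^ i) := by
    rw [map_mul, map_zpow, map_zpow, hx, hg, map_mul, map_zpow, map_zpow]
  exact congrArg Units.val h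

lemma counit_grpLike (r i : ℤ) : counit (R := k) (grpLike P r i) = 1 := by
  let f : GenLiu P →* k := (counitHom P : GenLiu P →* k)
  have hx : Units.map f (xU P) = 1 := Units.ext (counitHom_gen P .x)
  have hg : Units.map f (gU P) = 1 := Units.ext (counitHom_gen P .g)
  have h : Units.map f (xU P ^ r * gU P ^ i) = 1 := by
    rw [map_mul, map_zpow, map_zpow, hx, hg, one_zpow, one_zpow, one_mul]
  exact congrArg Units.val h

lemma counit_coef (β : k) (r i : ℤ) (a l : ℕ) :
    counit (R := k) (coef P β r i a l) = if a = l then 1 else 0 := by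
  have hy : counit (R := k) (y P) = 0 := counitHom_gen P .y
  have hg : counit (R := k) (g P) = 1 := counitHom_gen P .g
  induction a generalizing l with
  | zero =>
    rcases l with _ | l
    · simpa [coef] using counit_grpLike r i
    · simp [coef]
  | succ a ih =>
    rcases l with _ | l
    · simp [coef, hy]
    · simp [coef, hy, hg, ih]

/-- The matrix `(c_β^{r,i}(a, l))` is a comatrix. -/
lemma comul_coef (β : k) (r i : ℤ) (a l N : ℕ) (hN : a ≤ N) :
    comul (R := k) (coef P β r i a l) =
      ∑ p ∈ Finset.range (N + 1), coef P β r i a p ⊗ₜ[k] coef P β r i p l := by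
  have hne := γ_ne P
  have cSg : comul (R := k) (antipode k (g P)) = antipode k (g P) ⊗ₜ antipode k (g P) := by
    have h1 : comul (R := k) (g P) = g P ⊗ₜ g P := comulHom_gen P .g
    have h2 : comul (R := k) (gInv P) * comul (R := k) (g P) = 1 := by
      rw [← Bialgebra.comul_mul, gInv_mul_g, Bialgebra.comul_one]
    have h3 : comul (R := k) (g P) * (gInv P ⊗ₜ[k] gInv P) = 1 := by
      rw [h1, Algebra.TensorProduct.tmul_mul_tmul, g_mul_gInv, Algebra.TensorProduct.one_def]
    rw [antipode_g]
    exact left_inv_eq_right_inv h2 h3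
  have cy : comul (R := k) (y P) = y P ⊗ₜ g P + 1 ⊗ₜ y P := comulHom_gen P .y
  have cSy : comul (R := k) (antipode k (y P)) =
      antipode k (y P) ⊗ₜ 1 + antipode k (g P) ⊗ₜ antipode k (y P) := by
    rw [antipode_y, map_neg, Bialgebra.comul_mul, ← antipode_g, cSg, cy, antipode_g, add_mul]
    simp [g_mul_gInv, TensorProduct.neg_tmul, TensorProduct.tmul_neg]
    abel
  induction a generalizing l N with
  | zero =>
    rw [Finset.sum_range_succ', Finset.sum_eq_zero, zero_add]
    · rcases l with _ | l
      · rw [coef]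
        exact comul_grpLike r i
      · simp [coef]
    · intro p _
      simp [coef]
  | succ a ih =>
    obtain ⟨N, rfl⟩ : ∃ M, N = M + 1 := ⟨N - 1, by omega⟩
    have key : ∀ l : ℕ, comul (R := k)
        (coef P β r i a l * antipode k (y P) +
          (β * (P.γ ^ l)⁻¹) • (y P * coef P β r i a l * antipode k (g P))) =
        ∑ p ∈ Finset.range (N + 1),
          ((coef P β r i a p * antipode k (y P) +
            (β * (P.γ ^ p)⁻¹) • (y P * coef P β r i a p * antipode k (g P))) ⊗ₜ[k]
              coef P β r i p l +
          (coef P β r i a p * antipode k (g P)) ⊗ₜ[k]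
            (coef P β r i p l * antipode k (y P) +
          (β * (P.γ ^ l)⁻¹) • (y P * coef P β r i p l * antipode k (g P)))) := by
      intro l
      rw [map_add, map_smul, Bialgebra.comul_mul, Bialgebra.comul_mul, Bialgebra.comul_mul,
        ih l N (by omega), cSg, cSy, cy, Finset.mul_sum, Finset.sum_mul, Finset.sum_mul,
        Finset.smul_sum, ← Finset.sum_add_distrib]
      refine Finset.sum_congr rfl fun p _ => ?_
      have h1 : g P * coef P β r i p l * antipode k (g P) =
          (P.γ ^ l * (P.γ ^ p)⁻¹) • coef P β r i p l := by
        rw [g_mul_coef, smul_mul_assoc, mul_assoc, antipode_g, g_mul_gInv, mul_one]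
      simp only [mul_add, add_mul, Algebra.TensorProduct.tmul_mul_tmul, mul_one, one_mul, h1,
        TensorProduct.tmul_smul, TensorProduct.add_tmul, TensorProduct.tmul_add, smul_add,
        smul_smul, TensorProduct.smul_tmul']
      rw [show β * (P.γ ^ l)⁻¹ * (P.γ ^ l * (P.γ ^ p)⁻¹) = β * (P.γ ^ p)⁻¹ by
        field_simp]
      abel
    have rhs : ∀ l : ℕ, ∑ p ∈ Finset.range (N + 1 + 1),
        coef P β r i (a + 1) p ⊗ₜ[k] coef P β r i p l =
        ∑ p ∈ Finset.range (N + 1),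
          ((coef P β r i a p * antipode k (y P) +
            (β * (P.γ ^ p)⁻¹) • (y P * coef P β r i a p * antipode k (g P))) ⊗ₜ[k]
              coef P β r i p l +
          (coef P β r i a p * antipode k (g P)) ⊗ₜ[k] coef P β r i (p + 1) l) := by
      intro l
      have hF := (Finset.sum_range_succ (fun p => (coef P β r i a p * antipode k (y P) +
          (β * (P.γ ^ p)⁻¹) • (y P * coef P β r i a p * antipode k (g P))) ⊗ₜ[k]
            coef P β r i p l) (N + 1)).symm.trans (Finset.sum_range_succ' _ (N + 1))
      rw [coef_of_lt β r i (by omega : a < N + 1)] at hF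
      simp only [zero_mul, mul_zero, smul_zero, add_zero, TensorProduct.zero_tmul] at hF
      rw [Finset.sum_add_distrib, hF, Finset.sum_range_succ' _ (N + 1)]
      simp only [coef, TensorProduct.add_tmul _ (coef P β r i a _ * antipode k (g P)),
        Finset.sum_add_distrib, pow_zero, inv_one, mul_one]
      abel
    rw [rhs]
    rcases l with _ | l
    · have := key 0
      simp only [pow_zero, inv_one, mul_one] at this
      rw [coef, this]
      simp only [coef]
    · rw [coef, map_add, key, Bialgebra.comul_mul, ih l N (by omega), cSg, Finset.sum_mul,
        ← Finset.sum_add_distrib]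
      refine Finset.sum_congr rfl fun p _ => ?_
      rw [coef, Algebra.TensorProduct.tmul_mul_tmul, TensorProduct.tmul_add _ _
        (coef P β r i p l * antipode k (g P)), add_assoc]

lemma coact_top :
    ∑ l ∈ Finset.range (τ.top + 1), coef P τ.β τ.r τ.i (τ.top + 1) l ⊗ₜ[k] vec τ l =
      (1 - τ.β ^ P.n) • ((coef P τ.β τ.r τ.i 0 0 -
        coef P τ.β τ.r τ.i τ.top τ.top * antipode k (g P)) ⊗ₜ[k] vec τ 0) := by
  have hne := γ_ne P
  rw [Finset.sum_range_succ', Finset.sum_eq_zero, zero_add]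
  · rw [TensorProduct.smul_tmul', coef_eq _ _ _ _ _ (Nat.zero_le _), coef_eq _ _ _ τ.top τ.top le_rfl,
      coef, Nat.sub_self, pow_zero, one_mul, smul_mul_assoc, antipode_g, grpLike_mul_gInv]
    congr 1
    have h1 : lam P.γ τ.β τ.i τ.top τ.top = 1 := by simp [lam]
    have h2 : lam P.γ τ.β τ.i (τ.top + 1) 0 =
        ∏ t ∈ Finset.Ico 0 (τ.top + 1), (τ.β - P.γ ^ (t - τ.i : ℤ)) := by simp [lam]
    rw [h1, h2, one_smul]
    rcases τ.top_cases with ⟨h, -, h'⟩ | ⟨-, h⟩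
    · rw [Finset.prod_eq_zero (i := τ.top) (by simp) (by rw [← h', sub_self]), h]
      simp
    · have h3 : (τ.i : ℤ) - τ.top - 1 = τ.i - P.n := by rw [← h]; push_cast; ring
      rw [h3, h, prod_root, Nat.sub_zero, y_pow]
      have h4 : x P ^ P.w * grpLike P τ.r (τ.i - P.n) = grpLike P τ.r τ.i := by
        rw [((x_central _).pow_left _).eq, ← g_pow, grpLike, grpLike]
        rw [show g P ^ P.n = ((gU P ^ (P.n : ℤ) : (GenLiu P)ˣ) : GenLiu P) by simp [gU],
          ← Units.val_mul, mul_assoc, ← zpow_add, sub_add_cancel]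
      rw [sub_mul, one_mul, h4, ← neg_sub (τ.β ^ P.n) 1, neg_smul, ← smul_neg, neg_sub]
  · intro l hl
    rw [Finset.mem_range] at hl
    rw [coef_eq _ _ _ _ _ (by omega)]
    have : lam P.γ τ.β τ.i (τ.top + 1) (l + 1) = 0 := by
      rw [lam]
      rcases τ.top_cases with ⟨-, -, h⟩ | ⟨-, h⟩
      · rw [Finset.prod_eq_zero (i := τ.top) (by simp; omega) (by rw [← h, sub_self]), mul_zero]
      · rw [h, gaussBinom_eq_zero P.prim (by omega) (by omega), zero_mul, zero_mul]
    rw [this, zero_smul, TensorProduct.zero_tmul]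

noncomputable instance : YetterDrinfeld k (GenLiu P) (StdModule τ) where
  coact := coact τ
  coassoc := by
    refine ext_vec τ fun a ha => ?_
    simp only [LinearMap.comp_apply]
    rw [coact_vec τ ha, map_sum, map_sum, map_sum]
    have h1 : ∀ l ∈ Finset.range (τ.top + 1), (coact τ).lTensor (GenLiu P)
        (coef P τ.β τ.r τ.i a l ⊗ₜ[k] vec τ l) = ∑ p ∈ Finset.range (τ.top + 1),
          coef P τ.β τ.r τ.i a l ⊗ₜ[k] (coef P τ.β τ.r τ.i l p ⊗ₜ[k] vec τ p) := by
      intro l hl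
      rw [Finset.mem_range] at hl
      rw [LinearMap.lTensor_tmul, coact_vec τ (by omega), TensorProduct.tmul_sum]
    rw [Finset.sum_congr rfl h1, Finset.sum_comm]
    refine Finset.sum_congr rfl fun l _ => ?_
    rw [LinearMap.rTensor_tmul, comul_coef _ _ _ _ _ _ ha, TensorProduct.sum_tmul, map_sum]
    simp
  counit_coact := by
    refine ext_vec τ fun a ha => ?_
    simp only [LinearMap.comp_apply]
    rw [coact_vec τ ha, map_sum, map_sum, Finset.sum_eq_single a]
    · simp [counit_coef]
    · intro b _ hb
      simp [counit_coef, hb.symm]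
    · intro h
      simp at h
      omega
  compat := by
    intro h
    suffices H : coact τ ∘ₗ rep τ h = ydTwist k (GenLiu P) (StdModule τ) h ∘ₗ coact τ from
      fun v => LinearMap.congr_fun H v
    induction h using GenLiu.induction with
    | halg c =>
      rw [Algebra.algebraMap_eq_smul_one, map_smul, map_smul, map_one, ydTwist_one]
      ext; simp
    | hmul a b ha hb =>
      rw [map_mul, ydTwist_mul, Module.End.mul_eq_comp, Module.End.mul_eq_comp,
        ← LinearMap.comp_assoc, ha, LinearMap.comp_assoc, hb, LinearMap.comp_assoc]
    | hadd a b ha hb => rw [map_add, map_add, LinearMap.comp_add, LinearMap.add_comp, ha, hb]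
    | hgen a =>
      have hrep : rep τ (gen P a) = actGen τ a := GenLiu.lift_gen ..
      rw [hrep]
      have hco : comul (R := k) (gen P a) = comulGen P a := comulHom_gen P a
      refine ext_vec τ fun b hb => ?_
      simp only [LinearMap.comp_apply]
      rw [coact_vec τ hb, map_sum]
      cases a
      · have tw : ∀ u v, ydTwist k (GenLiu P) (StdModule τ) (gen P .x) (u ⊗ₜ v) =
            u ⊗ₜ actGen τ .x v := by
          intro u v
          simp [ydTwist, hco, comulGen, gen_smul, antipode_x, ← mul_assoc, (x_central u).eq]
          simp [mul_assoc, x_mul_xInv]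
        simp only [tw]
        simp [actGen, coact_vec τ hb, Finset.smul_sum]
      · have tw : ∀ u v, ydTwist k (GenLiu P) (StdModule τ) (gen P .xInv) (u ⊗ₜ v) =
            u ⊗ₜ actGen τ .xInv v := by
          intro u v
          simp [ydTwist, hco, comulGen, gen_smul, antipode_xInv, (x_central u).eq.symm]
          simp [← mul_assoc, xInv_mul_x]
        simp only [tw]
        simp [actGen, coact_vec τ hb, Finset.smul_sum]
      · have tw : ∀ u v, ydTwist k (GenLiu P) (StdModule τ) (gen P .g) (u ⊗ₜ v) =
            (g P * u * gInv P) ⊗ₜ actGen τ .g v := by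
          intro u v
          simp [ydTwist, hco, comulGen, gen_smul, antipode_g, mul_assoc]
        rw [actGen_g_vec, map_smul, coact_vec τ hb, Finset.smul_sum]
        refine Finset.sum_congr rfl fun l _ => ?_
        have hne := γ_ne P
        rw [tw, g_mul_coef, smul_mul_assoc, mul_assoc, g_mul_gInv, mul_one, actGen_g_vec,
          TensorProduct.tmul_smul, TensorProduct.smul_tmul', TensorProduct.smul_tmul', smul_smul]
        congr 2
        field_simp
      · have tw : ∀ u v, ydTwist k (GenLiu P) (StdModule τ) (gen P .y) (u ⊗ₜ v) =
            (y P * u * antipode k (g P)) ⊗ₜ actGen τ .g v +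
              ((u * antipode k (g P)) ⊗ₜ actGen τ .y v + (u * antipode k (y P)) ⊗ₜ v) := by
          intro u v
          have hcg : comul (R := k) (g P) = comulGen P .g := comulHom_gen P _
          simp [ydTwist, hco, hcg, comulGen, gen_smul, mul_assoc, TensorProduct.tmul_add]
        have hL : ∀ l : ℕ, ydTwist k (GenLiu P) (StdModule τ) (gen P .y)
            (coef P τ.β τ.r τ.i b l ⊗ₜ vec τ l) =
            (coef P τ.β τ.r τ.i b l * antipode k (y P) +
              (τ.β * (P.γ ^ l)⁻¹) • (y P * coef P τ.β τ.r τ.i b l * antipode k (g P)))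
                ⊗ₜ vec τ l +
            (coef P τ.β τ.r τ.i b l * antipode k (g P)) ⊗ₜ actGen τ .y (vec τ l) := by
          intro l
          rw [tw, actGen_g_vec, TensorProduct.tmul_smul, TensorProduct.add_tmul,
            TensorProduct.smul_tmul']
          abel
        have hR : ∑ l ∈ Finset.range (τ.top + 1), coef P τ.β τ.r τ.i (b + 1) l ⊗ₜ[k] vec τ l =
            ∑ l ∈ Finset.range (τ.top + 1),
              (coef P τ.β τ.r τ.i b l * antipode k (y P) +
              (τ.β * (P.γ ^ l)⁻¹) • (y P * coef P τ.β τ.r τ.i b l * antipode k (g P)))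
                ⊗ₜ vec τ l +
            ∑ l ∈ Finset.range τ.top,
              (coef P τ.β τ.r τ.i b l * antipode k (g P)) ⊗ₜ actGen τ .y (vec τ l) := by
          rw [Finset.sum_range_succ', Finset.sum_range_succ' _ τ.top, add_right_comm,
            ← Finset.sum_add_distrib]
          congr 1
          · refine Finset.sum_congr rfl fun l hl => ?_
            rw [coef, TensorProduct.add_tmul, actGen_y_vec τ (by simpa using hl)]
          · simp [coef]
        rw [Finset.sum_congr rfl fun l _ => hL l, Finset.sum_add_distrib,
          Finset.sum_range_succ _ τ.top, Finset.sum_range_succ (fun l =>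
            (coef P τ.β τ.r τ.i b l * antipode k (g P)) ⊗ₜ[k] actGen τ .y (vec τ l)) τ.top,
          ← Finset.sum_range_succ _ τ.top, ← add_assoc, ← hR]
        rcases hb.eq_or_lt with rfl | hb'
        · rw [coact_top, actGen_y_top, map_smul, coact_vec τ (Nat.zero_le _),
            Finset.sum_eq_single 0, TensorProduct.tmul_smul, ← smul_add,
            ← TensorProduct.add_tmul, sub_add_cancel]
          · intro l _ hl
            rw [coef_of_lt _ _ _ (Nat.pos_of_ne_zero hl), TensorProduct.zero_tmul]
          · simp
        · rw [actGen_y_vec τ hb', coact_vec τ hb', coef_of_lt _ _ _ hb']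
          simp

end StdModule
end SimpleModules

end LiuYD

/-!
The scalar `q` by which a one-dimensional object is braided with itself controls the Nichols
algebra. If `h` acts by `q` on a vector `v` with coaction `h ⊗ v`, then
`Δ_{1^N}(v ^ N) = [N]_q! v^{⊗ N}`, so all powers of `v` survive in the Nichols algebra as soon as no
`[N]_q` vanishes. Dually, a functional `f` that turns the coaction into multiplication by `h` and
the action of `h` into multiplication by `q` presents a one-dimensional braided quotient. On degree
`N` it satisfies `f^{⊗ N} Δ_{1^N} = [N]_q! f^{⊗ N}`, which gives the same conclusion.

In `V(α, β, x ^ r g ^ i)` the vector `v_0` spans a line with group-like element `x ^ r g ^ i`, and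
the coordinate of the last basis vector `v_m` gives a quotient line with group-like element
`x ^ r g ^ (i - m)`. Since `α ^ w = β ^ n`, the scalar `q` of a line with group-like element
`x ^ r g ^ j` satisfies `q ^ (w n) = β ^ (n (n r + w j))`, so it is a root of unity only if
`n r + w j = 0`. As `β ^ n ≠ 1` forces `m = n - 1`, this cannot happen for both `j = i` and
`j = i - m` unless `n = 1`, and then `q = α ^ r β ^ i = α ^ (r + w i) = 1`, whose quantum integers
do not vanish in characteristic zero.
-/

namespace LiuYD

section QuantumNumbers

/-- The quantum integer `[m]_q = 1 + q + ⋯ + q ^ (m - 1)`. -/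
def qNumber {R : Type*} [Semiring R] (q : R) (m : ℕ) : R := ∑ j ∈ Finset.range m, q ^ j

/-- The quantum factorial `[m]_q! = [1]_q [2]_q ⋯ [m]_q`. -/
def qFactorial {R : Type*} [CommSemiring R] (q : R) (m : ℕ) : R :=
  ∏ j ∈ Finset.range m, qNumber q (j + 1)

lemma qNumber_one_right {R : Type*} [Semiring R] (q : R) : qNumber q 1 = 1 := by
  simp [qNumber]

lemma qNumber_one_left {R : Type*} [Semiring R] (m : ℕ) : qNumber (1 : R) m = m := by
  simp [qNumber]

lemma qNumber_succ {R : Type*} [Semiring R] (q : R) (m : ℕ) :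
    qNumber q (m + 1) = 1 + q * qNumber q m := by
  rw [qNumber, geom_sum_succ, add_comm, qNumber]

lemma qNumber_ne_zero {R : Type*} [Ring R] {q : R} (hq : ¬ IsOfFinOrder q) {m : ℕ} (hm : 0 < m) :
    qNumber q m ≠ 0 := by
  intro h
  have hpow : q ^ m - 1 = 0 := by rw [← mul_geom_sum q m, ← qNumber, h, mul_zero]
  exact hq (isOfFinOrder_iff_pow_eq_one.2 ⟨m, hm, sub_eq_zero.1 hpow⟩)

section
variable {R : Type*} [CommSemiring R]

lemma qFactorial_succ (q : R) (m : ℕ) :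
    qFactorial q (m + 1) = qFactorial q m * qNumber q (m + 1) :=
  Finset.prod_range_succ ..

lemma qFactorial_one_right (q : R) : qFactorial q 1 = 1 := by
  simp [qFactorial, qNumber_one_right]

variable [NoZeroDivisors R] [Nontrivial R]

lemma qFactorial_ne_zero {q : R} {m : ℕ} (hq : ∀ j, qNumber q (j + 1) ≠ 0) :
    qFactorial q m ≠ 0 :=
  Finset.prod_ne_zero_iff.2 fun j _ => hq j

end

end QuantumNumbers

section RootsOfUnity
variable {G₀ : Type*} [CommGroupWithZero G₀]

lemma zpow_mul_zpow_pow_eq {a b : G₀} {w n : ℕ} (hb : b ≠ 0) (hab : a ^ w = b ^ n) (r i : ℤ) :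
    (a ^ r * b ^ i) ^ w = b ^ (n * r + w * i : ℤ) := by
  have ha : (a ^ r) ^ w = b ^ (n * r : ℤ) := by
    rw [← zpow_natCast, zpow_comm, zpow_natCast, hab, zpow_mul, zpow_natCast]
  rw [mul_pow, ha, ← zpow_natCast (b ^ i), ← zpow_mul, mul_comm i, zpow_add₀ hb]

lemma not_isOfFinOrder_zpow_mul_zpow {a b : G₀} {w n : ℕ} (hab : a ^ w = b ^ n)
    (hb₀ : b ≠ 0) (hb : ¬ IsOfFinOrder b) {r i : ℤ} (h : (n * r + w * i : ℤ) ≠ 0) :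
    ¬ IsOfFinOrder (a ^ r * b ^ i) := by
  intro hfin
  obtain ⟨e, he, hpow⟩ := isOfFinOrder_iff_zpow_eq_one.1 (hfin.pow (n := w))
  rw [zpow_mul_zpow_pow_eq hb₀ hab, ← zpow_mul] at hpow
  exact hb (isOfFinOrder_iff_zpow_eq_one.2 ⟨_, mul_ne_zero h he, hpow⟩)

end RootsOfUnity

section TensorAlgebra
open TensorAlgebra
variable {R M : Type*} [CommSemiring R] [AddCommMonoid M] [Module R M]

lemma tensorAlgebra_left_induction {C : TensorAlgebra R M → Prop} (one : C 1)
    (smul : ∀ (c : R) t, C t → C (c • t)) (add : ∀ s t, C s → C t → C (s + t))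
    (ι_mul : ∀ v t, C t → C (ι R v * t)) (t : TensorAlgebra R M) : C t := by
  suffices h : ∀ a t : TensorAlgebra R M, C t → C (a * t) by simpa using h t 1 one
  intro a
  induction a using TensorAlgebra.induction with
  | algebraMap r => intro t ht; rw [← Algebra.smul_def]; exact smul r t ht
  | ι v => exact ι_mul v
  | mul a b ha hb => intro t ht; rw [mul_assoc]; exact ha _ (hb _ ht)
  | add a b ha hb => intro t ht; rw [add_mul]; exact add _ _ (ha _ ht) (hb _ ht)

lemma algebraMapInv_ι (v : M) : algebraMapInv (ι R v) = 0 := by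
  simp [algebraMapInv]

lemma ιInv_one : (ιInv (1 : TensorAlgebra R M) : M) = 0 := by
  let : Module Rᵐᵒᵖ M := Module.compHom _ ((RingHom.id R).fromOpposite mul_comm)
  have : IsCentralScalar R M := ⟨fun r m => rfl⟩
  simp [ιInv]

lemma ιInv_ι_mul (v : M) (t : TensorAlgebra R M) : ιInv (ι R v * t) = algebraMapInv t • v := by
  let : Module Rᵐᵒᵖ M := Module.compHom _ ((RingHom.id R).fromOpposite mul_comm)
  have : IsCentralScalar R M := ⟨fun r m => rfl⟩
  have hfst : (TrivSqZeroExt.fstHom R R M).comp toTrivSqZeroExt =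
      (algebraMapInv : TensorAlgebra R M →ₐ[R] R) := by
    ext v
    simp [algebraMapInv]
  rw [← AlgHom.congr_fun hfst t]
  simp [ιInv]

end TensorAlgebra

section Action
open Coalgebra TensorAlgebra
variable {k H V : Type*} [Field k] [Ring H] [HopfAlgebra k H]
  [AddCommGroup V] [Module k V] [Module H V] [IsScalarTower k H V]

lemma tensorAct_one (h : H) :
    tensorAct k H V h 1 = algebraMap k (TensorAlgebra k V) (counit h) := by
  simp [tensorAct]

lemma tensorAct_ι (h : H) (v : V) : tensorAct k H V h (ι k v) = ι k (h • v) := by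
  simp [tensorAct, tensorActConv]

lemma tensorAct_mul {I : Type*} {h : H} (𝓡 : Coalgebra.Repr k h I) (s t : TensorAlgebra k V) :
    tensorAct k H V h (s * t) =
      ∑ i ∈ 𝓡.index, tensorAct k H V (𝓡.left i) s * tensorAct k H V (𝓡.right i) t := by
  simp [tensorAct, LinearMap.convMul_apply, ← 𝓡.eq]

lemma one_tensorAct (t : TensorAlgebra k V) : tensorAct k H V 1 t = t := by
  induction t using tensorAlgebra_left_induction with
  | one => simp [tensorAct_one]
  | smul c t ht => rw [map_smul, ht]
  | add s t hs ht => rw [map_add, hs, ht]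
  | ι_mul v t ht =>
    let 𝓡 : Coalgebra.Repr k (1 : H) Unit :=
      ⟨{()}, fun _ => 1, fun _ => 1, by simp [Algebra.TensorProduct.one_def]⟩
    simp [tensorAct_mul 𝓡, 𝓡, tensorAct_ι, ht]

lemma algebraMapInv_tensorAct (h : H) (t : TensorAlgebra k V) :
    algebraMapInv (tensorAct k H V h t) = counit (R := k) h * algebraMapInv t := by
  induction t using tensorAlgebra_left_induction with
  | one => rw [tensorAct_one, AlgHom.commutes, map_one, mul_one, Algebra.algebraMap_self_apply]
  | smul c t ht => rw [map_smul, map_smul, ht, map_smul, mul_smul_comm]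
  | add s t hs ht => rw [map_add, map_add, hs, ht, map_add, mul_add]
  | ι_mul v t _ => simp [tensorAct_mul (ℛ k h), tensorAct_ι, algebraMapInv_ι]

lemma ιInv_tensorAct (h : H) (t : TensorAlgebra k V) :
    ιInv (tensorAct k H V h t) = h • (ιInv t : V) := by
  induction t using tensorAlgebra_left_induction with
  | one => rw [tensorAct_one, Algebra.algebraMap_eq_smul_one, map_smul, ιInv_one, smul_zero,
      smul_zero]
  | smul c t ht => rw [map_smul, map_smul, ht, map_smul, smul_algebra_smul_comm]
  | add s t hs ht => rw [map_add, map_add, hs, ht, map_add, smul_add]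
  | ι_mul v t _ =>
    have hcounit : ∑ i ∈ (ℛ k h).index, counit (R := k) ((ℛ k h).right i) • (ℛ k h).left i = h := by
      simpa only [map_sum, TensorProduct.rid_tmul, one_smul] using
        congrArg (TensorProduct.rid k H) (sum_tmul_counit_eq (ℛ k h))
    calc ιInv (tensorAct k H V h (ι k v * t))
        = ∑ i ∈ (ℛ k h).index,
            (counit (R := k) ((ℛ k h).right i) * algebraMapInv t) • (ℛ k h).left i • v := by
          simp only [tensorAct_mul (ℛ k h), map_sum, tensorAct_ι, ιInv_ι_mul,
            algebraMapInv_tensorAct]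
      _ = algebraMapInv t •
            (∑ i ∈ (ℛ k h).index, counit (R := k) ((ℛ k h).right i) • (ℛ k h).left i) • v := by
          simp only [Finset.sum_smul, Finset.smul_sum, smul_assoc, smul_smul, mul_comm]
      _ = h • ιInv (ι k v * t) := by rw [hcounit, ιInv_ι_mul, smul_algebra_smul_comm]

end Action

section BraidedLeftMul
open Coalgebra TensorAlgebra
variable {k H V M N : Type*} [CommSemiring k] [AddCommMonoid H] [Module k H]
  [AddCommMonoid V] [Module k V] [AddCommMonoid M] [Module k M] [AddCommMonoid N] [Module k N]

/-- For an action `ρ` of `H` on `M`, the operator `m ⊗ t ↦ ρ(h) m ⊗ w t` on `M ⊗ T(V)` attached to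
`h ⊗ w`. For `h ⊗ w = δ(v)` it is the left multiplication by `1 ⊗ v` in the braided tensor product,
with the first factor `T(V)` replaced by `M`. -/
noncomputable def braidedLeftMul (ρ : H →ₗ[k] Module.End k M) :
    H ⊗[k] V →ₗ[k] Module.End k (M ⊗[k] TensorAlgebra k V) :=
  TensorProduct.lift ((TensorProduct.mapBilinear (RingHom.id k) M (TensorAlgebra k V) M
    (TensorAlgebra k V)).compl₁₂ ρ (LinearMap.mul k (TensorAlgebra k V) ∘ₗ ι k))

lemma braidedLeftMul_tmul_tmul (ρ : H →ₗ[k] Module.End k M) (h : H) (w : V) (m : M)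
    (t : TensorAlgebra k V) :
    braidedLeftMul ρ (h ⊗ₜ w) (m ⊗ₜ t) = ρ h m ⊗ₜ (ι k w * t) := by
  simp [braidedLeftMul]

lemma rTensor_braidedLeftMul {ρ : H →ₗ[k] Module.End k M} {σ : H →ₗ[k] Module.End k N}
    {L : M →ₗ[k] N} (hL : ∀ h m, L (ρ h m) = σ h (L m)) (z : H ⊗[k] V)
    (s : M ⊗[k] TensorAlgebra k V) :
    L.rTensor _ (braidedLeftMul ρ z s) = braidedLeftMul σ z (L.rTensor _ s) := by
  induction z using TensorProduct.induction_on with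
  | zero => simp only [map_zero, LinearMap.zero_apply]
  | add z z' hz hz' => simp only [map_add, LinearMap.add_apply, hz, hz']
  | tmul h w =>
    induction s using TensorProduct.induction_on with
    | zero => simp only [map_zero]
    | add s s' hs hs' => simp only [map_add, hs, hs']
    | tmul m t => simp only [LinearMap.rTensor_tmul, braidedLeftMul_tmul_tmul, hL]

lemma lid_braidedLeftMul_mul (φ : H →ₗ[k] k) (z : H ⊗[k] V) (s : k ⊗[k] TensorAlgebra k V) :
    TensorProduct.lid k _ (braidedLeftMul (LinearMap.mul k k ∘ₗ φ) z s) =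
      ι k (TensorProduct.lid k V (φ.rTensor V z)) * TensorProduct.lid k _ s := by
  induction z using TensorProduct.induction_on with
  | zero => simp only [map_zero, LinearMap.zero_apply, zero_mul]
  | add z z' hz hz' => simp only [map_add, LinearMap.add_apply, hz, hz', add_mul]
  | tmul h w =>
    induction s using TensorProduct.induction_on with
    | zero => simp only [map_zero, mul_zero]
    | add s s' hs hs' => simp only [map_add, hs, hs', mul_add]
    | tmul c t => simp [braidedLeftMul_tmul_tmul, mul_smul, smul_comm c]

end BraidedLeftMul

section
variable {k C D : Type*} [Field k] [AddCommGroup C] [Module k C] [AddCommGroup D] [Module k D]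

lemma map_comp_tensorCons (f : C →ₗ[k] D) (m : ℕ) :
    PiTensorProduct.map (fun _ => f) ∘ₗ tensorCons k m =
      tensorCons k m ∘ₗ TensorProduct.map f (PiTensorProduct.map fun _ => f) := by
  ext a b
  simp only [LinearMap.compMultilinearMap_apply, TensorProduct.AlgebraTensorModule.curry_apply,
    LinearMap.restrictScalars_self, TensorProduct.curry_apply, LinearMap.comp_apply,
    TensorProduct.map_tmul, tensorCons_tmul_tprod, PiTensorProduct.map_tprod]
  congr 1
  ext j
  cases j using Fin.cases <;> rfl

end

section HeadComul
open Coalgebra TensorAlgebra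
variable {k : Type*} (H : Type*) {V : Type*} [Field k] [Ring H] [HopfAlgebra k H]
  [AddCommGroup V] [Module k V] [Module H V] [IsScalarTower k H V] [YetterDrinfeld k H V]

lemma braidedMul_tmul_one (a : TensorAlgebra k V) :
    braidedMul k H V (a ⊗ₜ 1) = (LinearMap.mulLeft k a).rTensor _ := by
  refine TensorProduct.ext' fun s t => ?_
  simp [braidedMul, tensorBraiding, Algebra.TensorProduct.one_def, one_tensorAct]

lemma braidedMul_one_tmul_ι (v : V) :
    braidedMul k H V (1 ⊗ₜ ι k v) =
      braidedLeftMul (tensorAct k H V) (YetterDrinfeld.coact v) := by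
  refine TensorProduct.ext' fun a b => ?_
  have hcoact : tensorCoact k H V (ι k v) =
      (ι k).lTensor H (YetterDrinfeld.coact (k := k) (H := H) v) := by
    simp [tensorCoact]
  simp only [braidedMul, tensorBraiding, TensorProduct.curry_apply, LinearMap.comp_apply,
    LinearEquiv.coe_coe, TensorProduct.assoc_tmul, LinearMap.lTensor_tmul,
    TensorProduct.assoc_symm_tmul, LinearMap.rTensor_tmul, AlgHom.toLinearMap_apply, hcoact]
  induction (YetterDrinfeld.coact v : H ⊗[k] V) using TensorProduct.induction_on with
  | zero => simp
  | tmul h w => simp [braidedLeftMul_tmul_tmul]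
  | add z z' hz hz' =>
    simp only [map_add, TensorProduct.add_tmul, TensorProduct.tmul_add, LinearMap.add_apply, hz,
      hz']

lemma rTensor_tensorComul_ι_mul {M : Type*} [AddCommGroup M] [Module k M]
    {ρ : H →ₗ[k] Module.End k M} {L : TensorAlgebra k V →ₗ[k] M}
    (hL : ∀ h a, L (tensorAct k H V h a) = ρ h (L a)) (v : V) (t : TensorAlgebra k V) :
    L.rTensor _ (tensorComul k H V (ι k v * t)) =
      (L ∘ₗ LinearMap.mulLeft k (ι k v)).rTensor _ (tensorComul k H V t) +
        braidedLeftMul ρ (YetterDrinfeld.coact v) (L.rTensor _ (tensorComul k H V t)) := by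
  rw [tensorComul_ι_mul, map_add, LinearMap.add_apply, map_add, braidedMul_tmul_one,
    braidedMul_one_tmul_ι, rTensor_braidedLeftMul hL, LinearMap.rTensor_comp_apply]

lemma lid_rTensor_algebraMapInv_tensorComul (t : TensorAlgebra k V) :
    TensorProduct.lid k _ (algebraMapInv.toLinearMap.rTensor _ (tensorComul k H V t)) = t := by
  have hact (h : H) (a : TensorAlgebra k V) : algebraMapInv.toLinearMap (tensorAct k H V h a) =
      (LinearMap.mul k k ∘ₗ counit) h (algebraMapInv.toLinearMap a) :=
    algebraMapInv_tensorAct h a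
  have hmul (v : V) : algebraMapInv.toLinearMap ∘ₗ LinearMap.mulLeft k (ι k v) = 0 :=
    LinearMap.ext fun a => by simp [algebraMapInv_ι]
  have hcounit (v : V) : TensorProduct.lid k V ((counit (R := k) (A := H)).rTensor V
      (YetterDrinfeld.coact v)) = v :=
    LinearMap.congr_fun YetterDrinfeld.counit_coact v
  induction t using tensorAlgebra_left_induction with
  | one => simp [tensorComul_one]
  | smul c t ht => simp only [map_smul, ht]
  | add s t hs ht => simp only [map_add, hs, ht]
  | ι_mul v t ht =>
    rw [rTensor_tensorComul_ι_mul H hact, hmul, LinearMap.rTensor_zero, LinearMap.zero_apply,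
      zero_add, lid_braidedLeftMul_mul, hcounit, ht]

/-- The component of the comultiplication `Δ` of `T(V)` whose first tensor factor has degree one,
`(π₁ ⊗ id) Δ : T(V) → V ⊗ T(V)`. -/
noncomputable def headComul : TensorAlgebra k V →ₗ[k] V ⊗[k] TensorAlgebra k V :=
  ιInv.rTensor _ ∘ₗ tensorComul k H V

lemma headComul_one : headComul H (1 : TensorAlgebra k V) = 0 := by
  simp [headComul, tensorComul_one, ιInv_one]

lemma headComul_ι_mul (v : V) (t : TensorAlgebra k V) :
    headComul H (ι k v * t) = v ⊗ₜ t +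
      braidedLeftMul (Algebra.lsmul k k V).toLinearMap (YetterDrinfeld.coact (H := H) v)
        (headComul H t) := by
  have hact (h : H) (a : TensorAlgebra k V) : ιInv (tensorAct k H V h a) =
      (Algebra.lsmul k k V).toLinearMap h (ιInv a) :=
    ιInv_tensorAct h a
  have hmul : ιInv ∘ₗ LinearMap.mulLeft k (ι k v) =
      LinearMap.toSpanSingleton k V v ∘ₗ algebraMapInv.toLinearMap :=
    LinearMap.ext fun a => by simp [ιInv_ι_mul]
  have htmul (s : k ⊗[k] TensorAlgebra k V) :
      (LinearMap.toSpanSingleton k V v).rTensor _ s = v ⊗ₜ TensorProduct.lid k _ s := by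
    suffices hlin : (LinearMap.toSpanSingleton k V v).rTensor (TensorAlgebra k V) =
        TensorProduct.mk k V _ v ∘ₗ (TensorProduct.lid k _).toLinearMap from
      LinearMap.congr_fun hlin s
    ext
    simp
  rw [headComul, LinearMap.comp_apply, rTensor_tensorComul_ι_mul H hact, hmul,
    LinearMap.rTensor_comp_apply, htmul, lid_rTensor_algebraMapInv_tensorComul,
    LinearMap.comp_apply]

lemma deltaOne_zero (t : TensorAlgebra k V) :
    deltaOne k H V 0 t = PiTensorProduct.tprod k fun _ => ιInv t := by
  simp [deltaOne, iterComul, PiTensorProduct.subsingletonEquiv_symm_apply']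

lemma deltaOne_succ (m : ℕ) (t : TensorAlgebra k V) :
    deltaOne k H V (m + 1) t =
      tensorCons k (m + 1) ((deltaOne k H V m).lTensor V (headComul H t)) := by
  have hmap : (deltaOne k H V m).lTensor V ∘ₗ ιInv.rTensor _ =
      TensorProduct.map ιInv (PiTensorProduct.map fun _ => ιInv) ∘ₗ
        (iterComul (tensorComul k H V) m).lTensor _ :=
    TensorProduct.ext' fun a b => by simp [deltaOne]
  rw [headComul, LinearMap.comp_apply, ← LinearMap.comp_apply (LinearMap.lTensor V _), hmap,
    LinearMap.comp_apply, ← LinearMap.comp_apply (tensorCons k (m + 1)), ← map_comp_tensorCons]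
  rfl

end HeadComul

section TensorPowers

section
variable {R M : Type*} [CommSemiring R] [AddCommMonoid M] [Module R M]

/-- The functional `f^{⊗ m}` on `M^{⊗ m}`. -/
noncomputable def tensorPowFunctional (f : M →ₗ[R] R) (m : ℕ) :
    (PiTensorProduct R fun _ : Fin m => M) →ₗ[R] R :=
  PiTensorProduct.lift ((MultilinearMap.mkPiAlgebra R (Fin m) R).compLinearMap fun _ => f)

lemma tensorPowFunctional_tprod (f : M →ₗ[R] R) (m : ℕ) (a : Fin m → M) :
    tensorPowFunctional f m (PiTensorProduct.tprod R a) = ∏ j, f (a j) := by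
  simp [tensorPowFunctional]

end

variable {k V : Type*} [Field k] [AddCommGroup V] [Module k V]

lemma tensorPowFunctional_comp_tensorCons (f : V →ₗ[k] k) (m : ℕ) :
    tensorPowFunctional f (m + 1) ∘ₗ tensorCons k m =
      LinearMap.mul' k k ∘ₗ TensorProduct.map f (tensorPowFunctional f m) := by
  ext a b
  simp [tensorCons_tmul_tprod, tensorPowFunctional_tprod, Fin.prod_univ_succ]

lemma tprod_const_ne_zero {v : V} (hv : v ≠ 0) (m : ℕ) :
    PiTensorProduct.tprod k (fun _ : Fin m => v) ≠ 0 := by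
  obtain ⟨f, hf⟩ := Module.Projective.exists_dual_ne_zero k hv
  intro h
  have hprod := tensorPowFunctional_tprod f m fun _ => v
  rw [h, map_zero, eq_comm, Finset.prod_const] at hprod
  exact pow_ne_zero _ hf hprod

end TensorPowers

lemma linearIndependent_of_pairwise_apply_eq_zero {I R W : Type*} {N : I → Type*} [Ring R]
    [IsDomain R] [AddCommGroup W] [Module R W] [∀ i, AddCommGroup (N i)] [∀ i, Module R (N i)]
    [∀ i, Module.IsTorsionFree R (N i)] {u : I → W} (F : ∀ i, W →ₗ[R] N i)
    (hdiag : ∀ i, F i (u i) ≠ 0) (hoff : ∀ i j, j ≠ i → F i (u j) = 0) : LinearIndependent R u := by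
  rw [linearIndependent_iff']
  intro s c hs i hi
  have hF : F i (∑ j ∈ s, c j • u j) = c i • F i (u i) := by
    rw [map_sum, Finset.sum_eq_single_of_mem i hi fun j _ hj => by rw [map_smul, hoff i j hj,
      smul_zero], map_smul]
  rw [hs, map_zero, eq_comm, smul_eq_zero] at hF
  exact hF.resolve_right (hdiag i)

section SymbolHom
open TensorAlgebra Polynomial
variable {R V : Type*} [CommSemiring R] [AddCommMonoid V] [Module R V]

/-- The algebra map `T(V) → R[X]` with `v ↦ f(v) X`, the one induced on tensor algebras by the
functional `f : V → R`. -/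
noncomputable def symbolHom (f : V →ₗ[R] R) : TensorAlgebra R V →ₐ[R] R[X] :=
  TensorAlgebra.lift R (f.smulRight X)

lemma symbolHom_ι_mul (f : V →ₗ[R] R) (v : V) (t : TensorAlgebra R V) :
    symbolHom f (ι R v * t) = f v • (X * symbolHom f t) := by
  simp [symbolHom]

lemma coeff_zero_symbolHom (f : V →ₗ[R] R) (t : TensorAlgebra R V) :
    (symbolHom f t).coeff 0 = algebraMapInv t := by
  have hcomp : (aeval (0 : R)).comp (symbolHom f) = algebraMapInv := by
    ext v
    simp [symbolHom, algebraMapInv_ι]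
  rw [← hcomp, AlgHom.comp_apply, coeff_zero_eq_aeval_zero]

lemma coeff_one_symbolHom (f : V →ₗ[R] R) (t : TensorAlgebra R V) :
    (symbolHom f t).coeff 1 = f (ιInv t) := by
  induction t using tensorAlgebra_left_induction with
  | one => simp [ιInv_one, coeff_one]
  | smul c t ht => simp only [map_smul, coeff_smul, ht]
  | add s t hs ht => simp only [map_add, coeff_add, hs, ht]
  | ι_mul v t _ =>
    rw [symbolHom_ι_mul, coeff_smul, coeff_X_mul, coeff_zero_symbolHom, ιInv_ι_mul, map_smul,
      smul_eq_mul, smul_eq_mul, mul_comm]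

end SymbolHom

section
open TensorAlgebra Polynomial
variable {k H V : Type*} [Field k] [Ring H] [Algebra k H] [AddCommGroup V] [Module k V]
  [Module H V] [IsScalarTower k H V]
  {f : V →ₗ[k] k} {h : H} {q : k}

lemma lid_map_symbolHom_braidedLeftMul (hact : ∀ v, f (h • v) = q * f v) {z : H ⊗[k] V} {c : k}
    (hz : TensorProduct.rid k H (f.lTensor H z) = c • h) (s : V ⊗[k] TensorAlgebra k V) :
    TensorProduct.lid k _ (TensorProduct.map f (symbolHom f).toLinearMap
        (braidedLeftMul (Algebra.lsmul k k V).toLinearMap z s)) =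
      (c * q) • (X * TensorProduct.lid k _ (TensorProduct.map f (symbolHom f).toLinearMap s)) := by
  induction s using TensorProduct.induction_on with
  | zero => simp
  | add s s' hs hs' => simp only [map_add, hs, hs', mul_add, smul_add]
  | tmul w t =>
    have key : TensorProduct.lid k _ (TensorProduct.map f (symbolHom f).toLinearMap
        (braidedLeftMul (Algebra.lsmul k k V).toLinearMap z (w ⊗ₜ t))) =
          f (TensorProduct.rid k H (f.lTensor H z) • w) • (X * symbolHom f t) := by
      clear hz
      induction z using TensorProduct.induction_on with
      | zero => simp
      | add z z' hz hz' => simp only [map_add, LinearMap.add_apply, hz, hz', add_smul]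
      | tmul a u =>
        simp [braidedLeftMul_tmul_tmul, symbolHom_ι_mul, smul_smul]
    rw [key, hz, smul_assoc, map_smul, hact]
    simp [smul_smul, mul_assoc]

end

section Nichols
open TensorAlgebra
variable {k : Type*} (H : Type*) {V : Type*} [Field k] [Ring H] [HopfAlgebra k H]
  [AddCommGroup V] [Module k V] [Module H V] [IsScalarTower k H V] [YetterDrinfeld k H V]

instance : GradedAlgebra (tensorDegree k V) := TensorAlgebra.gradedAlgebra

lemma nicholsIdeal_le_ker (m : ℕ) :
    nicholsIdeal k H V ≤
      LinearMap.ker (deltaOne k H V (m + 1) ∘ₗ GradedAlgebra.proj (tensorDegree k V) (m + 2)) := by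
  refine iSup_le fun j t ⟨hdeg, hker⟩ => ?_
  rw [LinearMap.mem_ker, LinearMap.comp_apply, GradedAlgebra.proj_apply]
  obtain rfl | hj := eq_or_ne j m
  · rwa [DirectSum.decompose_of_mem_same _ hdeg]
  · rw [DirectSum.decompose_of_mem_ne _ hdeg (by omega), map_zero]

theorem not_finiteDimensional_nicholsAlgebra (t : ℕ → TensorAlgebra k V)
    (hdeg : ∀ m, t m ∈ tensorDegree k V (m + 2)) (ht : ∀ m, deltaOne k H V (m + 1) (t m) ≠ 0) :
    ¬ FiniteDimensional k (NicholsAlgebra k H V) := by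
  intro _
  refine Module.Finite.not_linearIndependent_of_infinite
    (fun m => (nicholsIdeal k H V).mkQ (t m)) (linearIndependent_of_pairwise_apply_eq_zero
      (fun m => (nicholsIdeal k H V).liftQ _ (nicholsIdeal_le_ker H m)) ?_ ?_)
  · intro m
    simpa [DirectSum.decompose_of_mem_same _ (hdeg m)] using ht m
  · intro i j hij
    simp [DirectSum.decompose_of_mem_ne _ (hdeg j) (by omega : j + 2 ≠ i + 2)]

lemma ι_pow_mem_tensorDegree (v : V) (m : ℕ) : ι k v ^ m ∈ tensorDegree k V m :=
  Submodule.pow_mem_pow _ (LinearMap.mem_range_self _ v) m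

section BraidedLine
variable {H} {v : V} {h : H} {q : k}

lemma headComul_ι_pow_succ (hcoact : YetterDrinfeld.coact (k := k) v = h ⊗ₜ v)
    (hact : h • v = q • v) (m : ℕ) :
    headComul H (ι k v ^ (m + 1)) = qNumber q (m + 1) • (v ⊗ₜ[k] (ι k v ^ m)) := by
  induction m with
  | zero =>
    rw [pow_succ', headComul_ι_mul, pow_zero, headComul_one, map_zero, add_zero, zero_add,
      qNumber_one_right, one_smul]
  | succ m ih =>
    rw [pow_succ', headComul_ι_mul, ih, hcoact, map_smul, braidedLeftMul_tmul_tmul,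
      AlgHom.toLinearMap_apply, Algebra.lsmul_apply, hact, ← pow_succ', TensorProduct.smul_tmul',
      smul_smul, qNumber_succ q (m + 1), add_smul, one_smul, mul_comm q,
      TensorProduct.smul_tmul']

lemma deltaOne_ι_pow (hcoact : YetterDrinfeld.coact (k := k) v = h ⊗ₜ v)
    (hact : h • v = q • v) (m : ℕ) :
    deltaOne k H V m (ι k v ^ (m + 1)) =
      qFactorial q (m + 1) • PiTensorProduct.tprod k fun _ => v := by
  induction m with
  | zero => rw [deltaOne_zero, qFactorial_one_right, one_smul, zero_add, pow_one, ι_leftInverse]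
  | succ m ih =>
    have hcons : Fin.cons v (fun _ : Fin (m + 1) => v) = fun _ : Fin (m + 2) => v :=
      Fin.cons_self_tail fun _ => v
    rw [deltaOne_succ, headComul_ι_pow_succ hcoact hact, map_smul, LinearMap.lTensor_tmul, ih,
      TensorProduct.tmul_smul, map_smul, map_smul, tensorCons_tmul_tprod, smul_smul, hcons,
      mul_comm, ← qFactorial_succ]

theorem not_finiteDimensional_nicholsAlgebra_of_braidedLine (hv : v ≠ 0)
    (hcoact : YetterDrinfeld.coact (k := k) v = h ⊗ₜ v) (hact : h • v = q • v)
    (hq : ∀ m, qNumber q (m + 1) ≠ 0) : ¬ FiniteDimensional k (NicholsAlgebra k H V) := by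
  refine not_finiteDimensional_nicholsAlgebra H (fun m => ι k v ^ (m + 2))
    (fun m => ι_pow_mem_tensorDegree v (m + 2)) fun m => ?_
  rw [deltaOne_ι_pow hcoact hact]
  exact smul_ne_zero (qFactorial_ne_zero hq) (tprod_const_ne_zero hv _)

end BraidedLine

section BraidedQuotientLine
open Polynomial
variable {H} {f : V →ₗ[k] k} {h : H} {q : k}

lemma coeff_lid_map_headComul
    (hcoact : ∀ v, TensorProduct.rid k H (f.lTensor H (YetterDrinfeld.coact v)) = f v • h)
    (hact : ∀ v, f (h • v) = q * f v) (t : TensorAlgebra k V) (m : ℕ) :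
    (TensorProduct.lid k _ (TensorProduct.map f (symbolHom f).toLinearMap (headComul H t))).coeff m
      = qNumber q (m + 1) * (symbolHom f t).coeff (m + 1) := by
  induction t using tensorAlgebra_left_induction generalizing m with
  | one => simp [headComul_one, coeff_one]
  | smul c t ht => simp only [map_smul, coeff_smul, ht, smul_eq_mul, mul_left_comm]
  | add s t hs ht => simp only [map_add, coeff_add, hs, ht, mul_add]
  | ι_mul v t ht =>
    rw [headComul_ι_mul, map_add, map_add, lid_map_symbolHom_braidedLeftMul hact (hcoact v),
      symbolHom_ι_mul, coeff_add, coeff_smul, coeff_smul, coeff_X_mul, qNumber_succ]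
    cases m with
    | zero => simp [qNumber]
    | succ m =>
      rw [coeff_X_mul, ht]
      simp only [TensorProduct.map_tmul, TensorProduct.lid_tmul, AlgHom.toLinearMap_apply,
        coeff_smul, smul_eq_mul]
      ring

lemma tensorPowFunctional_deltaOne
    (hcoact : ∀ v, TensorProduct.rid k H (f.lTensor H (YetterDrinfeld.coact v)) = f v • h)
    (hact : ∀ v, f (h • v) = q * f v) (m : ℕ) (t : TensorAlgebra k V) :
    tensorPowFunctional f (m + 1) (deltaOne k H V m t) =
      qFactorial q (m + 1) * (symbolHom f t).coeff (m + 1) := by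
  induction m generalizing t with
  | zero =>
    simp [deltaOne_zero, tensorPowFunctional_tprod, qFactorial_one_right, coeff_one_symbolHom]
  | succ m ih =>
    have hlin (s : V ⊗[k] TensorAlgebra k V) : tensorPowFunctional f (m + 2)
        (tensorCons k (m + 1) ((deltaOne k H V m).lTensor V s)) = qFactorial q (m + 1) *
          (TensorProduct.lid k _
            (TensorProduct.map f (symbolHom f).toLinearMap s)).coeff (m + 1) := by
      rw [← LinearMap.comp_apply (tensorPowFunctional f (m + 2)),
        tensorPowFunctional_comp_tensorCons]
      induction s using TensorProduct.induction_on with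
      | zero => simp
      | add s s' hs hs' => simp only [map_add, hs, hs', coeff_add, mul_add]
      | tmul w t => simp [ih, mul_left_comm]
    rw [deltaOne_succ, hlin, coeff_lid_map_headComul hcoact hact, ← mul_assoc, ← qFactorial_succ]

theorem not_finiteDimensional_nicholsAlgebra_of_braidedQuotientLine (hf : f ≠ 0)
    (hcoact : ∀ v, TensorProduct.rid k H (f.lTensor H (YetterDrinfeld.coact v)) = f v • h)
    (hact : ∀ v, f (h • v) = q * f v)
    (hq : ∀ m, qNumber q (m + 1) ≠ 0) : ¬ FiniteDimensional k (NicholsAlgebra k H V) := by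
  obtain ⟨v, hv⟩ : ∃ v, f v ≠ 0 := DFunLike.ne_iff.1 hf
  refine not_finiteDimensional_nicholsAlgebra H (fun m => ι k v ^ (m + 2))
    (fun m => ι_pow_mem_tensorDegree v (m + 2)) fun m hzero => ?_
  have hval := tensorPowFunctional_deltaOne hcoact hact (m + 1) (ι k v ^ (m + 2))
  have hsymbol : symbolHom f (ι k v ^ (m + 2)) = f v ^ (m + 2) • X ^ (m + 2) := by
    simp [symbolHom, _root_.smul_pow]
  rw [hzero, map_zero, hsymbol, coeff_smul, coeff_X_pow_self, smul_eq_mul, mul_one] at hval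
  exact mul_ne_zero (qFactorial_ne_zero hq) (pow_ne_zero _ hv) hval.symm

end BraidedQuotientLine
end Nichols

lemma zpow_smul_eq_zpow_smul {G G₀ M : Type*} [Group G] [GroupWithZero G₀] [MulAction G M]
    [MulAction G₀ M] [SMulCommClass G G₀ M] {g : G} {c : G₀} {v : M} (hc : c ≠ 0)
    (h : g • v = c • v) (a : ℤ) : g ^ a • v = c ^ a • v := by
  have hinv : g⁻¹ • v = c⁻¹ • v := by
    rw [inv_smul_eq_iff, smul_comm, h, inv_smul_smul₀ hc]
  induction a using Int.induction_on with
  | zero => rw [zpow_zero, zpow_zero, one_smul, one_smul]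
  | succ a ih =>
    rw [zpow_add_one, mul_smul, h, smul_comm, ih, smul_smul, add_comm, zpow_one_add₀ hc]
  | pred a ih =>
    rw [zpow_sub_one, mul_smul, hinv, smul_comm, ih, smul_smul, ← neg_add_eq_sub, zpow_add₀ hc,
      zpow_neg_one]

namespace StdModule
variable {k : Type*} [Field k] {P : LiuParam k} (τ : StdType P)
open GenLiu

section Weights

/-- The eigenvalue `β γ ^ (-a)` of `g` on the basis vector `v_a`. -/
def gWeight (a : ℕ) : k := τ.β * (P.γ ^ a)⁻¹

lemma gWeight_pow (a : ℕ) : gWeight τ a ^ P.n = τ.β ^ P.n := by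
  rw [gWeight, mul_pow, inv_pow, pow_right_comm, P.prim.pow_eq_one, one_pow, inv_one, mul_one]

lemma gWeight_ne_zero (a : ℕ) : gWeight τ a ≠ 0 :=
  mul_ne_zero τ.β_ne (inv_ne_zero (pow_ne_zero _ (γ_ne P)))

variable {τ}

lemma not_isOfFinOrder_gWeight (hβ : ¬ IsOfFinOrder τ.β) (a : ℕ) :
    ¬ IsOfFinOrder (gWeight τ a) := by
  have hpow : ¬ IsOfFinOrder (gWeight τ a ^ P.n) := by
    rw [gWeight_pow]
    exact fun h => hβ (h.of_pow P.n_pos.ne')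
  exact fun h => hpow h.pow

lemma qNumber_zpow_mul_gWeight_zpow_ne_zero (hβ : ¬ IsOfFinOrder τ.β) {r i : ℤ}
    (h : P.n * r + P.w * i ≠ 0) (a m : ℕ) :
    qNumber (τ.α ^ r * gWeight τ a ^ i) (m + 1) ≠ 0 :=
  qNumber_ne_zero (not_isOfFinOrder_zpow_mul_zpow (τ.rel.trans (gWeight_pow τ a).symm)
    (gWeight_ne_zero τ a) (not_isOfFinOrder_gWeight hβ a) h) m.succ_pos

variable (τ)

lemma grpLike_smul_vec (r i : ℤ) (a : ℕ) :
    grpLike P r i • vec τ a = (τ.α ^ r * gWeight τ a ^ i) • vec τ a := by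
  have hx : xU P • vec τ a = τ.α • vec τ a := by
    rw [Units.smul_def, show (xU P : GenLiu P) = gen P .x from rfl, gen_smul]
    simp [actGen]
  have hg : gU P • vec τ a = gWeight τ a • vec τ a := by
    rw [Units.smul_def, show (gU P : GenLiu P) = gen P .g from rfl, gen_smul, actGen_g_vec,
      gWeight]
  rw [grpLike, ← Units.smul_def, mul_smul, zpow_smul_eq_zpow_smul (gWeight_ne_zero τ a) hg,
    smul_comm, zpow_smul_eq_zpow_smul τ.α_ne hx, smul_smul, mul_comm]

end Weights

lemma vec_zero_ne_zero : vec τ 0 ≠ 0 := by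
  rw [vec, dif_pos τ.top.succ_pos]
  exact (basis τ).ne_zero _

lemma coact_vec_zero : YetterDrinfeld.coact (k := k) (vec τ 0) =
    grpLike P τ.r τ.i ⊗ₜ[k] vec τ 0 := by
  change coact τ (vec τ 0) = _
  rw [coact_vec τ (Nat.zero_le _), Finset.sum_eq_single_of_mem 0 (by simp), coef]
  intro l _ hl
  rw [coef_of_lt _ _ _ (Nat.pos_of_ne_zero hl), TensorProduct.zero_tmul]

/-- The coordinate functional of the last basis vector `v_m`, which presents a line as a braided
quotient of `V(α, β, x ^ r g ^ i)`. -/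
noncomputable def topCoord : StdModule τ →ₗ[k] k := (basis τ).coord ⟨τ.top, τ.top.lt_succ_self⟩

lemma topCoord_vec {a : ℕ} (h : a ≤ τ.top) :
    topCoord τ (vec τ a) = if a = τ.top then 1 else 0 := by
  rw [vec, dif_pos (Nat.lt_succ_of_le h), topCoord, Module.Basis.coord_apply,
    Module.Basis.repr_self, Finsupp.single_apply]
  simp only [Fin.mk.injEq]

lemma topCoord_ne_zero : topCoord τ ≠ 0 := by
  intro h
  have htop := topCoord_vec τ le_rfl
  rw [h, LinearMap.zero_apply, if_pos rfl] at htop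
  exact zero_ne_one htop

lemma topCoord_coact (v : StdModule τ) :
    TensorProduct.rid k (GenLiu P) ((topCoord τ).lTensor (GenLiu P)
      (YetterDrinfeld.coact v)) = topCoord τ v • grpLike P τ.r (τ.i - τ.top) := by
  suffices h : (TensorProduct.rid k (GenLiu P)).toLinearMap ∘ₗ
      (topCoord τ).lTensor (GenLiu P) ∘ₗ coact τ =
      (topCoord τ).smulRight (grpLike P τ.r (τ.i - τ.top)) from LinearMap.congr_fun h v
  refine ext_vec τ fun a ha => ?_
  have hsum : TensorProduct.rid k (GenLiu P) ((topCoord τ).lTensor (GenLiu P)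
      (coact τ (vec τ a))) = coef P τ.β τ.r τ.i a τ.top := by
    rw [coact_vec τ ha, map_sum, map_sum, Finset.sum_eq_single_of_mem τ.top (by simp)]
    · rw [LinearMap.lTensor_tmul, topCoord_vec τ le_rfl, if_pos rfl, TensorProduct.rid_tmul,
        one_smul]
    · intro l hl h
      rw [LinearMap.lTensor_tmul, topCoord_vec τ (Finset.mem_range_succ_iff.1 hl), if_neg h,
        TensorProduct.tmul_zero, map_zero]
  refine hsum.trans ?_
  rw [LinearMap.smulRight_apply, topCoord_vec τ ha]
  split_ifs with h
  · rw [h, coef_eq _ _ _ _ _ le_rfl]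
    simp [lam]
  · rw [coef_of_lt _ _ _ (ha.lt_of_ne h), zero_smul]

lemma topCoord_grpLike_smul (r i : ℤ) (v : StdModule τ) :
    topCoord τ (grpLike P r i • v) = τ.α ^ r * gWeight τ τ.top ^ i * topCoord τ v := by
  suffices h : topCoord τ ∘ₗ rep τ (grpLike P r i) =
      (τ.α ^ r * gWeight τ τ.top ^ i) • topCoord τ from LinearMap.congr_fun h v
  refine ext_vec τ fun a ha => ?_
  rw [LinearMap.comp_apply, ← smul_def, grpLike_smul_vec, map_smul, LinearMap.smul_apply,
    topCoord_vec τ ha]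
  split_ifs with h
  · rw [h]
  · rw [smul_zero, smul_zero]

section Nichols
variable {τ}

theorem not_finiteDimensional_nicholsAlgebra_of_add_ne_zero (hβ : ¬ IsOfFinOrder τ.β)
    (h : P.n * τ.r + P.w * τ.i ≠ 0) :
    ¬ FiniteDimensional k (NicholsAlgebra k (GenLiu P) (StdModule τ)) :=
  not_finiteDimensional_nicholsAlgebra_of_braidedLine (vec_zero_ne_zero τ) (coact_vec_zero τ)
    (grpLike_smul_vec τ _ _ _) (qNumber_zpow_mul_gWeight_zpow_ne_zero hβ h 0)

theorem not_finiteDimensional_nicholsAlgebra_of_add_sub_top_ne_zero (hβ : ¬ IsOfFinOrder τ.β)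
    (h : P.n * τ.r + P.w * (τ.i - τ.top) ≠ 0) :
    ¬ FiniteDimensional k (NicholsAlgebra k (GenLiu P) (StdModule τ)) :=
  not_finiteDimensional_nicholsAlgebra_of_braidedQuotientLine (topCoord_ne_zero τ)
    (topCoord_coact τ) (topCoord_grpLike_smul τ _ _)
    (qNumber_zpow_mul_gWeight_zpow_ne_zero hβ h τ.top)

theorem not_finiteDimensional_nicholsAlgebra_of_n_eq_one [CharZero k] (hn : P.n = 1)
    (h : P.n * τ.r + P.w * τ.i = 0) :
    ¬ FiniteDimensional k (NicholsAlgebra k (GenLiu P) (StdModule τ)) := by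
  have hscalar : τ.α ^ τ.r * gWeight τ 0 ^ τ.i = 1 := by
    have hrel : gWeight τ 0 = τ.α ^ P.w := by
      rw [τ.rel, ← gWeight_pow τ 0, hn, pow_one]
    have hexp : τ.r + P.w * τ.i = 0 := by rwa [hn, Nat.cast_one, one_mul] at h
    rw [hrel, ← zpow_natCast, ← zpow_mul, ← zpow_add₀ τ.α_ne, hexp, zpow_zero]
  refine not_finiteDimensional_nicholsAlgebra_of_braidedLine (vec_zero_ne_zero τ)
    (coact_vec_zero τ) (grpLike_smul_vec τ _ _ _) fun m => ?_
  rw [hscalar, qNumber_one_left]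
  exact Nat.cast_ne_zero.2 m.succ_ne_zero

end Nichols
end StdModule

end LiuYD

theorem lemma5p6_general {k : Type*} [Field k] [CharZero k] (P : LiuYD.LiuParam k)
    (τ : LiuYD.StdType P) (hβ : ¬ ∃ m : ℕ, 0 < m ∧ τ.β ^ m = 1) :
    ¬ FiniteDimensional k
      (LiuYD.NicholsAlgebra k (LiuYD.GenLiu P) (LiuYD.StdModule τ)) := by
  have hβ' : ¬ IsOfFinOrder τ.β := by rwa [isOfFinOrder_iff_pow_eq_one]
  by_cases h : P.n * τ.r + P.w * τ.i = 0
  · obtain hn | hn := eq_or_ne P.n 1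
    · exact LiuYD.StdModule.not_finiteDimensional_nicholsAlgebra_of_n_eq_one hn h
    · have htop : τ.top + 1 = P.n := by
        rcases τ.top_cases with ⟨hpow, -⟩ | ⟨-, htop⟩
        · exact absurd ⟨P.n, P.n_pos, hpow⟩ hβ
        · exact htop
      refine LiuYD.StdModule.not_finiteDimensional_nicholsAlgebra_of_add_sub_top_ne_zero hβ' ?_
      rw [mul_sub, ← add_sub_assoc, h, zero_sub, neg_ne_zero]
      have hw := P.w_pos
      exact mul_ne_zero (by omega) (by omega)
  · exact LiuYD.StdModule.not_finiteDimensional_nicholsAlgebra_of_add_ne_zero hβ' h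

/-- If `α` and `β` are not roots of unity, the Nichols algebra of the simple Yetter-Drinfeld module
`V(α, β, x ^ r g ^ i)` over the generalized Liu algebra `B(n, w, γ)` is infinite-dimensional. -/
theorem lemma5p6 {k : Type*} [Field k] [IsAlgClosed k] [CharZero k] (P : LiuYD.LiuParam k)
    (τ : LiuYD.StdType P)
    (hα : ¬ ∃ m : ℕ, 0 < m ∧ τ.α ^ m = 1) (hβ : ¬ ∃ m : ℕ, 0 < m ∧ τ.β ^ m = 1) :
    ¬ FiniteDimensional k
      (LiuYD.NicholsAlgebra k (LiuYD.GenLiu P) (LiuYD.StdModule τ)) :=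
  lemma5p6_general P τ hβ
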